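/- **Setting.** Let $d\in\{1,2,3\}$ and $\lambda>0$. For an integer $K\ge 1$ put $h=1/K$ and $\Delta t=\lambda h^2$ (so $\lambda=\Delta t/h^2$), and let $A\in\mathbb R^{(K-1)^d\times(K-1)^d}$ be the standard finite difference matrix of $-\Delta$ on $[0,1]^d$ with mesh width $h$, acting on the interior grid points. Consider an (explicit or implicit) $s$-stage Runge–Kutta method with Butcher tableau $(a,b,c)$, $\sum_i b_i=1$, and put $Q_j(z)=(b^T(I-za)^{-1})_j$ and $S(z)=1+z\sum_jQ_j(z)$ (the absolute stability function). Assume that $S$ has no poles on the negative real axis and that $|S(z)|<1$ for all $z\in[-4d\lambda,0)$. The exact fully discrete scheme is $$U^{n+1}=S(-\Delta tA)U^n+\Delta t\,F^n,\qquad F^n=\sum_{j=1}^sQ_j(-\Delta tA)f(n\Delta t+c_j\Delta t),$$ with arbitrary initial vector $U^0$ and arbitrary forcing $f:\mathbb R\to\mathbb R^{(K-1)^d}$ (which includes the boundary data). **Stochastic rounding (SR), delta form.** Let $F$ be the normalized base-2 floating point system with precision $t\ge1$ and roundoff unit $u=2^{-t}$, where underflow and overflow are ignored. SR rounds $x\in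 F$ to $x$, and $x\notin F$ with adjacent numbers $a<x<b$ of $F$ to $a$ with probability $(b-x)/(b-a)$ and to $b$ with probability $(x-a)/(b-a)$; these are conditional probabilities given the whole preceding history of the computation. In a delta-form implementation with $\hat U^0=U^0$, in each step $0\le n<N$ an increment $D^n$ is computed (possibly inexactly and randomly) and then $\hat U^{n+1}_j$ is the stochastic rounding of $\hat U^n_j+D^n_j$ for each $j$, one rounding after the other. Define $\delta^n_j$ by $\hat U^{n+1}_j=(1+\delta^n_j)(\hat U^n_j+D^n_j)$ (with $\delta^n_j=0$ if $\hat U^n_j+D^n_j=0$), and the leading local errors $\varepsilon^n_j=\delta^n_j\hat U^n_j$. Let $E^n$ be the global error deriving from these: $E^n=V^n-U^n$ with $V^{n+1}=S(-\Delta tA)V^n+\Delta tF^n+\varepsilon^n$, $V^0=U^0$, i.e. $E^0=0$ and $E^{n+1}=S(-\Delta tA)E^n+\varepsilon^n$. Write $\|v\|_{L^2}=K^{-d/2}\|v\|_2$, $\ell(\Delta t)=|\log(\lambda^{-1}\Delta t)|$ and, for a constant $C$, $$\phi_1(\Delta t)=C\Delta t^{-1},\qquad \phi_2(\Delta t)=C\Delta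 t^{-1}\ell(\Delta t),\qquad \phi_3(\Delta t)=C\Delta t^{-3/2}.$$ **Theorem.** There are constants $C,C'>0$, depending only on $d$, $\lambda$ and the Runge–Kutta method, such that for all $K\ge1$, $t\ge 1$, $N$, $U^0$, $f$ and all delta-form SR computations as above the following holds. 1. If $\|\hat U^n\|_\infty\le M$ almost surely for all $n<N$, then $|\varepsilon^n_j|\le 2uM$ almost surely for all $n<N$ and all $j$. 2. If $\varepsilon\ge0$ is such that $|\varepsilon^n_j|\le\varepsilon$ almost surely for all $n<N$ and all $j$, then for all $n\le N$ the random variables $\|E^n\|_{L^2}^2$ and $\|E^n\|_\infty$ are integrable, and $$\mathbb E\big[\|E^n\|_{L^2}^2\big]^{1/2}\le\varepsilon\,\lambda^{-d/4}\Delta t^{d/4}\sqrt{\phi_d(\Delta t)},$$ $$\mathbb E\big[\|E^n\|_\infty\big]\le 2^{2+d/2}\lambda^{-d/4}\,\varepsilon\,\Delta t^{d/4}\sqrt{\phi_d(\Delta t)}\,\sqrt{\tfrac d2\log(\lambda\Delta t^{-1})+\log 2}.$$ Moreover $\mathbb E[\|E^n\|_{L^2}^2]^{1/2}\le C'\varepsilon\,r_d(\Delta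 t)$ with $r_1=\Delta t^{-1/4}$, $r_2=\ell(\Delta t)^{1/2}$, $r_3=1$, and $\mathbb E[\|E^n\|_\infty]\le C'\varepsilon\,\rho_d(\Delta t)$ with $\rho_1=\Delta t^{-1/4}\ell(\Delta t)^{1/2}$, $\rho_2=\ell(\Delta t)$, $\rho_3=\ell(\Delta t)^{1/2}$. -/

import Mathlib

open MeasureTheory ProbabilityTheory Polynomial
open scoped Matrix

noncomputable section

/-! ### Floating point numbers and stochastic rounding -/

/-- The normalized base-2 floating point numbers with precision `t` (range effects are ignored,
so the exponent `e` is an arbitrary integer): zero and the numbers `± m * 2 ^ (e - t)` with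
`2 ^ (t - 1) ≤ m ≤ 2 ^ t - 1`. -/
def floatSystem (t : ℕ) : Set ℝ :=
  {y | y = 0 ∨ ∃ (m : ℕ) (e : ℤ), 2 ^ t ≤ 2 * m ∧ m < 2 ^ t ∧ |y| = (m : ℝ) * 2 ^ (e - (t : ℤ))}

/-- The roundoff unit `u = 2 ^ (-t)`. -/
def unitRoundoff (t : ℕ) : ℝ := (2 : ℝ) ^ (-(t : ℤ))

/-- The largest floating point number that is at most `x`. -/
def roundDown (t : ℕ) (x : ℝ) : ℝ := sSup {a | a ∈ floatSystem t ∧ a ≤ x}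

/-- The smallest floating point number that is at least `x`. -/
def roundUp (t : ℕ) (x : ℝ) : ℝ := sInf {b | b ∈ floatSystem t ∧ x ≤ b}

/-- `Y` is the result of stochastically rounding `X`, where `X` is known from the history `𝒢` and
the random choice is made with the prescribed probabilities given that history: with
`a ≤ X ≤ b` the adjacent floating point numbers, `Y = a` with probability `(b - X) / (b - a)` and
`Y = b` with probability `(X - a) / (b - a)`. If `X` is itself a floating point number then
`a = b = X` and `Y = X`. -/
structure IsStochasticRounding {Ω : Type*} [mΩ : MeasurableSpace Ω] (μ : Measure Ω) (t : ℕ)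
    (𝒢 : MeasurableSpace Ω) (X Y : Ω → ℝ) : Prop where
  measurable_input : Measurable[𝒢] X
  measurable_output : Measurable[mΩ] Y
  mem : ∀ᵐ ω ∂μ, Y ω = roundDown t (X ω) ∨ Y ω = roundUp t (X ω)
  prob_down : ∀ᵐ ω ∂μ, X ω ∉ floatSystem t →
    (μ⟦{ω' | Y ω' = roundDown t (X ω')}|𝒢⟧) ω =
      (roundUp t (X ω) - X ω) / (roundUp t (X ω) - roundDown t (X ω))
  prob_up : ∀ᵐ ω ∂μ, X ω ∉ floatSystem t →
    (μ⟦{ω' | Y ω' = roundUp t (X ω')}|𝒢⟧) ω =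
      (X ω - roundDown t (X ω)) / (roundUp t (X ω) - roundDown t (X ω))

/-! ### The finite difference Laplacian and Runge-Kutta time stepping -/

/-- Multi-indices of the interior grid points of `[0,1]^d` with mesh width `1 / K`; the index `i`
(with zero-based entries) stands for the point with coordinates `(i l + 1) / K`. -/
abbrev GridIndex (d K : ℕ) : Type := Fin d → Fin (K - 1)

/-- The tridiagonal second difference matrix `tridiag(-1, 2, -1)`. -/
def secondDiff (n : ℕ) : Matrix (Fin n) (Fin n) ℝ := fun a b =>
  if a = b then 2 else if (a : ℕ) + 1 = b ∨ (b : ℕ) + 1 = a then -1 else 0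

/-- The standard finite difference matrix of minus the `d`-dimensional Laplacian on the interior
grid points with mesh width `h = 1 / K`:
`(A v) i = h⁻² * ∑ l, (2 * v i - v (i + e_l) - v (i - e_l))`, where `v` vanishes on the boundary. -/
def fdLaplacian (d K : ℕ) : Matrix (GridIndex d K) (GridIndex d K) ℝ := fun i j =>
  (K : ℝ) ^ 2 * ∑ l : Fin d, if (∀ m, m ≠ l → i m = j m) then secondDiff (K - 1) (i l) (j l) else 0

/-- An `s`-stage (explicit or implicit) Runge-Kutta method given by its Butcher tableau, with the
consistency condition `∑ b = 1`. -/
structure RungeKutta (s : ℕ) where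
  a : Matrix (Fin s) (Fin s) ℝ
  b : Fin s → ℝ
  c : Fin s → ℝ
  consistent : ∑ i, b i = 1

/-- The rational functions `Q_j(z) = (bᵀ (I - z a)⁻¹)_j` that multiply the forcing term. -/
def RungeKutta.Q {s : ℕ} (rk : RungeKutta s) (j : Fin s) : RatFunc ℝ :=
  ∑ i, RatFunc.C (rk.b i) * (1 - (RatFunc.X : RatFunc ℝ) • rk.a.map RatFunc.C)⁻¹ i j

/-- The absolute stability function `S(z) = 1 + z bᵀ (I - z a)⁻¹ 1`. -/
def RungeKutta.S {s : ℕ} (rk : RungeKutta s) : RatFunc ℝ :=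
  1 + RatFunc.X * ∑ j, rk.Q j

/-- The value `W(B)⁻¹ N(B)` of the rational function `P = N / W` (in lowest terms) at a square
matrix `B`. -/
def ratMatrix {ι : Type*} [Fintype ι] [DecidableEq ι] (P : RatFunc ℝ) (B : Matrix ι ι ℝ) :
    Matrix ι ι ℝ :=
  (aeval B P.denom)⁻¹ * aeval B P.num

/-- One exact step of the fully discrete scheme:
`v ↦ S(-Δt A) v + Δt ∑ j, Q_j(-Δt A) f(n Δt + c_j Δt)`. -/
def RungeKutta.step {s : ℕ} (rk : RungeKutta s) (d K : ℕ) (dt : ℝ) (f : ℝ → GridIndex d K → ℝ)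
    (n : ℕ) (v : GridIndex d K → ℝ) : GridIndex d K → ℝ :=
  ratMatrix rk.S (-(dt • fdLaplacian d K)) *ᵥ v +
    dt • ∑ j, ratMatrix (rk.Q j) (-(dt • fdLaplacian d K)) *ᵥ f (n * dt + rk.c j * dt)

/-- The scheme with local errors `e n` added in step `n`, started from `U0`. For `e = 0` this is
the exact fully discrete solution `U`. -/
def RungeKutta.scheme {s : ℕ} (rk : RungeKutta s) (d K : ℕ) (dt : ℝ) (f : ℝ → GridIndex d K → ℝ)
    (U0 : GridIndex d K → ℝ) (e : ℕ → GridIndex d K → ℝ) : ℕ → GridIndex d K → ℝ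
  | 0 => U0
  | n + 1 => rk.step d K dt f n (rk.scheme d K dt f U0 e n) + e n

/-- The global error caused by the local errors `e`: the solution of the scheme with local errors
`e` minus the exact fully discrete solution. -/
def RungeKutta.globalError {s : ℕ} (rk : RungeKutta s) (d K : ℕ) (dt : ℝ)
    (f : ℝ → GridIndex d K → ℝ) (U0 : GridIndex d K → ℝ) (e : ℕ → GridIndex d K → ℝ) (n : ℕ) :
    GridIndex d K → ℝ :=
  rk.scheme d K dt f U0 e n - rk.scheme d K dt f U0 0 n

/-! ### Delta-form implementation with stochastic rounding -/

/-- `Uhat` is the result of `N` time steps of a delta-form implementation with stochastic rounding: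
the (possibly inexactly and randomly) computed increment `D n` is added to `Uhat n`, and each entry
of the sum is stochastically rounded. The filtration `𝒢` records the history of the computation,
operation by operation; `time n j` is the position at which the final addition in the `j`-th entry
of step `n` is performed. -/
structure IsDeltaFormSR {Ω : Type*} [mΩ : MeasurableSpace Ω] (μ : Measure Ω) (t : ℕ)
    {ι : Type*} (U0 : ι → ℝ) (N : ℕ) (𝒢 : Filtration ℕ mΩ) (time : ℕ → ι → ℕ)
    (D Uhat : ℕ → Ω → ι → ℝ) : Prop where
  init : ∀ ω, Uhat 0 ω = U0
  time_inj : ∀ m < N, ∀ n < N, ∀ i j, time m i = time n j → m = n ∧ i = j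
  measurable_current : ∀ n < N, ∀ j, Measurable[𝒢 (time n j)] (fun ω => Uhat n ω j)
  measurable_incr : ∀ n < N, ∀ j, Measurable[𝒢 (time n j)] (fun ω => D n ω j)
  measurable_next : ∀ n < N, ∀ j, Measurable[𝒢 (time n j + 1)] (fun ω => Uhat (n + 1) ω j)
  rounding : ∀ n < N, ∀ j, IsStochasticRounding μ t (𝒢 (time n j))
    (fun ω => Uhat n ω j + D n ω j) (fun ω => Uhat (n + 1) ω j)

/-- The relative error `δ` of the final addition: `Uhat (n+1) j = (1 + δ) * (Uhat n j + D n j)`.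
If the sum to be rounded is `0` then so is its rounding, and `δ = 0`. -/
def roundoff {Ω ι : Type*} (D Uhat : ℕ → Ω → ι → ℝ) (n : ℕ) (ω : Ω) (j : ι) : ℝ :=
  (Uhat (n + 1) ω j - (Uhat n ω j + D n ω j)) / (Uhat n ω j + D n ω j)

/-- The leading local rounding error `ε^n_j = δ^n_j * Uhat^n_j` of the delta form. -/
def leadingLocalError {Ω ι : Type*} (D Uhat : ℕ → Ω → ι → ℝ) (ω : Ω) (n : ℕ) (j : ι) : ℝ :=
  roundoff D Uhat n ω j * Uhat n ω j

/-! ### Norms and rates -/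

/-- The discrete `L²` norm `K^(-d/2) ‖v‖₂`. -/
def discreteL2Norm (d K : ℕ) (v : GridIndex d K → ℝ) : ℝ :=
  (K : ℝ) ^ (-(d : ℝ) / 2) * √(∑ i, v i ^ 2)

/-- `ℓ(Δt) = |log (λ⁻¹ Δt)|`. -/
def ell (lam dt : ℝ) : ℝ := |Real.log (lam⁻¹ * dt)|

/-- The function `φ_d(Δt)` with constant `C`, for `d = 1, 2, 3`. -/
def phi (d : ℕ) (C lam dt : ℝ) : ℝ :=
  match d with
  | 1 => C * dt⁻¹
  | 2 => C * dt⁻¹ * ell lam dt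
  | 3 => C * dt ^ (-(3 / 2) : ℝ)
  | _ => 0

/-- Growth rate of the global error in the `L²` norm, for `d = 1, 2, 3`. -/
def rateL2 (d : ℕ) (lam dt : ℝ) : ℝ :=
  match d with
  | 1 => dt ^ (-(1 / 4) : ℝ)
  | 2 => √(ell lam dt)
  | 3 => 1
  | _ => 0

/-- Growth rate of the global error in the maximum norm, for `d = 1, 2, 3`. -/
def rateMax (d : ℕ) (lam dt : ℝ) : ℝ :=
  match d with
  | 1 => dt ^ (-(1 / 4) : ℝ) * √(ell lam dt)
  | 2 => ell lam dt
  | 3 => √(ell lam dt)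
  | _ => 0

end

/-! ### Rounding -/

/-! Stochastic rounding is conditionally unbiased. The leading local error is the rounding error
times `Uhat / (Uhat + D)`, a factor known before the rounding, so the local errors, ordered by the
time of their rounding, form a bounded martingale difference sequence
(`IsDeltaFormSR.isMartingaleDifference`). They therefore add up like independent centered variables
rather than in the worst case.

Subtracting the two schemes cancels the forcing, and E^n is the sum over m < n of S(-Δt A)^(n-1-m)
ε^m. Orthogonality of the increments bounds the second moment of the j-th entry by ε² V_j, where V_j
sums the squares of row j of all the powers. The Azuma–Hoeffding argument bounds its moment
generating function with the same V_j, and the maximal inequality over at most K^d entries then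
costs the square root of a logarithm.

It remains to bound V_j. The discrete sine transform W is a symmetric involution diagonalizing A, so
summing geometric series gives V_j ≤ Σ_k W_jk² / (1 - S(z_k)²), uniformly in n, with z_k the
eigenvalues of -Δt A. Summing over j removes W, because its columns are unit vectors; this gives the
L² bound. For a single j one uses W_jk² ≤ (2/K)^d; this gives the maximum norm.

Finally S(z) = 1 + z + O(z²), stability and compactness give 1 - S(z)² ≥ c|z| on [-4dλ, 0)
(`RungeKutta.exists_le_one_sub_S_sq`), while |z_k| ≥ 4λ|k|²/K². So everything is controlled by K² Σ
|k|⁻² over frequencies 1 ≤ k_l < K. The lattice sum is O(1), O(log K), O(K) for d = 1, 2, 3, which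
is `phi` because K² = λ/Δt. -/

theorem zero_mem_floatSystem (t : ℕ) : (0 : ℝ) ∈ floatSystem t := Or.inl rfl

theorem neg_mem_floatSystem {t : ℕ} {x : ℝ} (hx : x ∈ floatSystem t) : -x ∈ floatSystem t := by
  simpa [floatSystem, abs_neg, neg_eq_zero] using hx

/-- On the binade [2^e, 2^(e+1)) the floating point numbers are the multiples of q = 2^(e+1-t), and
q = 2u·2^e ≤ 2ux. The bracket consists of the multiples of q around x. -/
theorem exists_floatSystem_bracket_of_pos (t : ℕ) (ht : 1 ≤ t) (x : ℝ) (hx : 0 < x) :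
    ∃ a ∈ floatSystem t, ∃ b ∈ floatSystem t, a ≤ x ∧ x ≤ b ∧ b - a ≤ 2 * unitRoundoff t * x := by
  obtain ⟨e, he1, he2⟩ := exists_mem_Ico_zpow hx (one_lt_two (α := ℝ))
  set q : ℝ := 2 ^ (e + 1 - (t : ℤ)) with hq
  have hq0 : 0 < q := by positivity
  have hqt : (2 : ℝ) ^ t * q = 2 ^ (e + 1) := by
    rw [hq, ← zpow_natCast, ← zpow_add₀ two_ne_zero]
    congr 1
    ring
  have h2e : (2 : ℝ) ^ (e + 1) = 2 * 2 ^ e := by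
    rw [zpow_add₀ two_ne_zero, zpow_one, mul_comm]
  set m := ⌊x / q⌋₊ with hm
  have hm1 : (m : ℝ) * q ≤ x := (le_div_iff₀ hq0).1 (Nat.floor_le (by positivity))
  have hm2 : x < (m + 1 : ℝ) * q := (div_lt_iff₀ hq0).1 (Nat.lt_floor_add_one _)
  have hm3 : m < 2 ^ t := by
    rw [hm, Nat.floor_lt (by positivity), div_lt_iff₀ hq0]
    push_cast
    rwa [hqt]
  have hpow : (2 : ℕ) ^ t = 2 * 2 ^ (t - 1) := by
    rw [← pow_succ', Nat.sub_add_cancel ht]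
  have hm4 : 2 ^ (t - 1) ≤ m := by
    rw [hm]
    apply Nat.le_floor
    rw [le_div_iff₀ hq0]
    have h1 : (2 : ℝ) ^ t = 2 * 2 ^ (t - 1) := by exact_mod_cast hpow
    push_cast
    rw [h1] at hqt
    linarith
  refine ⟨m * q, Or.inr ⟨m, e + 1, by omega, hm3, abs_of_nonneg (by positivity)⟩,
    (m + 1) * q, ?_, hm1, hm2.le, ?_⟩
  · right
    rcases Nat.lt_or_ge (m + 1) (2 ^ t) with h | h
    · exact ⟨m + 1, e + 1, by omega, h, by rw [abs_of_nonneg (by positivity)]; push_cast; rfl⟩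
    -- Here the upper neighbour is the power of two ending the binade, and its mantissa must be
    -- renormalized.
    · refine ⟨2 ^ (t - 1), e + 2, by omega, by have := Nat.one_le_two_pow (n := t - 1); omega, ?_⟩
      have h3 : (m : ℝ) + 1 = 2 * 2 ^ (t - 1) := by
        have : m + 1 = 2 * 2 ^ (t - 1) := by omega
        exact_mod_cast this
      have h4 : (2 : ℝ) ^ (e + 2 - (t : ℤ)) = 2 * q := by
        rw [hq, show e + 2 - (t : ℤ) = e + 1 - t + 1 by ring, zpow_add₀ two_ne_zero (e + 1 - t) 1,
          zpow_one, mul_comm]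
      rw [abs_of_nonneg (by positivity), h3, h4]
      push_cast
      ring
  · have h5 : q = 2 * unitRoundoff t * 2 ^ e := by
      rw [hq, unitRoundoff, show e + 1 - (t : ℤ) = 1 + -(t : ℤ) + e by ring,
        zpow_add₀ two_ne_zero, zpow_add₀ two_ne_zero, zpow_one]
    have h6 : 0 < unitRoundoff t := by
      rw [unitRoundoff]
      positivity
    calc (m + 1) * q - m * q = 2 * unitRoundoff t * 2 ^ e := by rw [← h5]; ring
      _ ≤ 2 * unitRoundoff t * x := by gcongr

theorem exists_floatSystem_bracket (t : ℕ) (ht : 1 ≤ t) (x : ℝ) :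
    ∃ a ∈ floatSystem t, ∃ b ∈ floatSystem t,
      a ≤ x ∧ x ≤ b ∧ b - a ≤ 2 * unitRoundoff t * |x| := by
  rcases lt_trichotomy x 0 with hx | rfl | hx
  · obtain ⟨a, ha, b, hb, hax, hxb, hab⟩ := exists_floatSystem_bracket_of_pos t ht (-x) (by linarith)
    refine ⟨-b, neg_mem_floatSystem hb, -a, neg_mem_floatSystem ha, by linarith, by linarith, ?_⟩
    rw [abs_of_neg hx]
    linarith
  · exact ⟨0, zero_mem_floatSystem t, 0, zero_mem_floatSystem t, le_rfl, le_rfl, by simp⟩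
  · rw [abs_of_pos hx]
    exact exists_floatSystem_bracket_of_pos t ht x hx

theorem le_roundDown {t : ℕ} {a x : ℝ} (ha : a ∈ floatSystem t) (hax : a ≤ x) :
    a ≤ roundDown t x :=
  le_csSup ⟨x, fun _ hy => hy.2⟩ ⟨ha, hax⟩

theorem roundUp_le {t : ℕ} {b x : ℝ} (hb : b ∈ floatSystem t) (hxb : x ≤ b) :
    roundUp t x ≤ b :=
  csInf_le ⟨x, fun _ hy => hy.2⟩ ⟨hb, hxb⟩

theorem roundDown_le {t : ℕ} (ht : 1 ≤ t) (x : ℝ) : roundDown t x ≤ x := by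
  obtain ⟨a, ha, -, -, hax, -⟩ := exists_floatSystem_bracket t ht x
  exact csSup_le ⟨a, ha, hax⟩ fun _ hy => hy.2

theorem le_roundUp {t : ℕ} (ht : 1 ≤ t) (x : ℝ) : x ≤ roundUp t x := by
  obtain ⟨-, -, b, hb, -, hxb, -⟩ := exists_floatSystem_bracket t ht x
  exact le_csInf ⟨b, hb, hxb⟩ fun _ hy => hy.2

theorem roundDown_of_mem {t : ℕ} (ht : 1 ≤ t) {x : ℝ} (hx : x ∈ floatSystem t) :
    roundDown t x = x :=
  (roundDown_le ht x).antisymm (le_roundDown hx le_rfl)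

theorem roundUp_of_mem {t : ℕ} (ht : 1 ≤ t) {x : ℝ} (hx : x ∈ floatSystem t) :
    roundUp t x = x :=
  (roundUp_le hx le_rfl).antisymm (le_roundUp ht x)

/-- Any bracket of x by floating point numbers contains both roundings, so the supremum and infimum
need not be shown to be attained. -/
theorem roundUp_sub_roundDown_le {t : ℕ} (ht : 1 ≤ t) (x : ℝ) :
    roundUp t x - roundDown t x ≤ 2 * unitRoundoff t * |x| := by
  obtain ⟨a, ha, b, hb, hax, hxb, hab⟩ := exists_floatSystem_bracket t ht x
  have h1 := le_roundDown ha hax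
  have h2 := roundUp_le hb hxb
  linarith

theorem measurable_roundDown {t : ℕ} (ht : 1 ≤ t) : Measurable (roundDown t) := by
  apply Monotone.measurable
  intro x y hxy
  obtain ⟨a, ha, -, -, hax, -⟩ := exists_floatSystem_bracket t ht x
  exact csSup_le_csSup ⟨y, fun _ hz => hz.2⟩ ⟨a, ha, hax⟩ fun z hz => ⟨hz.1, hz.2.trans hxy⟩

theorem measurable_roundUp {t : ℕ} (ht : 1 ≤ t) : Measurable (roundUp t) := by
  apply Monotone.measurable
  intro x y hxy
  obtain ⟨-, -, b, hb, -, hxb, -⟩ := exists_floatSystem_bracket t ht y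
  exact csInf_le_csInf ⟨x, fun _ hz => hz.2⟩ ⟨b, hb, hxb⟩ fun z hz => ⟨hz.1, hxy.trans hz.2⟩

/-- A rounding error times a quantity known beforehand has conditional expectation zero. -/
theorem IsStochasticRounding.condExp_mul_sub_eq_zero {Ω : Type*} {𝒢 : MeasurableSpace Ω}
    [mΩ : MeasurableSpace Ω] {μ : Measure Ω} [IsProbabilityMeasure μ] {t : ℕ} (ht : 1 ≤ t)
    (h𝒢 : 𝒢 ≤ mΩ) {X Y : Ω → ℝ} (h : IsStochasticRounding μ t 𝒢 X Y) {g : Ω → ℝ}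
    (hg : Measurable[𝒢] g) {ε : ℝ} (hε : 0 ≤ ε) (hb : ∀ᵐ ω ∂μ, |g ω * (Y ω - X ω)| ≤ ε) :
    μ[fun ω => g ω * (Y ω - X ω)|𝒢] =ᵐ[μ] 0 := by
  set lo : Ω → ℝ := fun ω => roundDown t (X ω) with hlo
  set up : Ω → ℝ := fun ω => roundUp t (X ω) with hup
  have hlom : Measurable[𝒢] lo := (measurable_roundDown ht).comp h.measurable_input
  have hupm : Measurable[𝒢] up := (measurable_roundUp ht).comp h.measurable_input
  have hA : MeasurableSet {ω | Y ω = lo ω} :=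
    measurableSet_eq_fun h.measurable_output (hlom.mono h𝒢 le_rfl)
  have hB : MeasurableSet {ω | Y ω = up ω} :=
    measurableSet_eq_fun h.measurable_output (hupm.mono h𝒢 le_rfl)
  set A : Ω → ℝ := {ω | Y ω = lo ω}.indicator (fun _ => (1 : ℝ)) with hAdef
  set B : Ω → ℝ := {ω | Y ω = up ω}.indicator (fun _ => (1 : ℝ)) with hBdef
  have hAi : Integrable A μ := (integrable_const (1 : ℝ)).indicator hA
  have hBi : Integrable B μ := (integrable_const (1 : ℝ)).indicator hB
  set p : Ω → ℝ := fun ω => g ω * (lo ω - X ω) with hp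
  set q : Ω → ℝ := fun ω => g ω * (up ω - X ω) with hq
  have hpm : Measurable[𝒢] p := hg.mul (hlom.sub h.measurable_input)
  have hqm : Measurable[𝒢] q := hg.mul (hupm.sub h.measurable_input)
  -- The factor `g` may be unbounded; the hypothesis controls `p` only on the event that `Y` is
  -- rounded down, so integrability holds only after multiplication by the indicator.
  have hpA : Integrable (p * A) μ := by
    refine Integrable.of_bound (((hpm.mono h𝒢 le_rfl).aestronglyMeasurable).mul
      hAi.aestronglyMeasurable) ε ?_
    filter_upwards [hb] with ω hω
    by_cases hc : Y ω = lo ω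
    · rw [hc] at hω
      simpa [hAdef, hp, hc, abs_mul] using hω
    · simpa [hAdef, hc] using hε
  have hqB : Integrable (q * B) μ := by
    refine Integrable.of_bound (((hqm.mono h𝒢 le_rfl).aestronglyMeasurable).mul
      hBi.aestronglyMeasurable) ε ?_
    filter_upwards [hb] with ω hω
    by_cases hc : Y ω = up ω
    · rw [hc] at hω
      simpa [hBdef, hq, hc, abs_mul] using hω
    · simpa [hBdef, hc] using hε
  have hdec : (fun ω => g ω * (Y ω - X ω)) =ᵐ[μ] p * A + q * B := by
    filter_upwards [h.mem] with ω hω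
    have h1 : lo ω ≤ X ω := roundDown_le ht _
    have h2 : X ω ≤ up ω := le_roundUp ht _
    simp only [Pi.add_apply, Pi.mul_apply, hp, hq, hAdef, hBdef, Set.indicator_apply,
      Set.mem_ofPred_eq]
    by_cases h3 : Y ω = lo ω
    · by_cases h4 : Y ω = up ω
      -- The two events overlap only where `X` is already representable, and there both terms
      -- vanish.
      · have h5 : X ω = Y ω := by linarith
        simp [← h3, ← h4, h5]
      · simp only [h3, if_true]
        rw [if_neg (by rwa [← h3])]
        ring
    · have h4 : Y ω = up ω := hω.resolve_left h3
      simp only [h4, if_true]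
      rw [if_neg (by rwa [← h4])]
      ring
  refine (condExp_congr_ae hdec).trans ?_
  refine (condExp_add hpA hqB 𝒢).trans ?_
  filter_upwards [condExp_mul_of_stronglyMeasurable_left hpm.stronglyMeasurable hpA hAi,
    condExp_mul_of_stronglyMeasurable_left hqm.stronglyMeasurable hqB hBi,
    h.prob_down, h.prob_up] with ω h1 h2 h3 h4
  rw [Pi.add_apply, h1, h2, Pi.mul_apply, Pi.mul_apply]
  by_cases hX : X ω ∈ floatSystem t
  · simp [hp, hq, hlo, hup, roundDown_of_mem ht hX, roundUp_of_mem ht hX]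
  · have h3' : (μ[A|𝒢]) ω = (up ω - X ω) / (up ω - lo ω) := h3 hX
    have h4' : (μ[B|𝒢]) ω = (X ω - lo ω) / (up ω - lo ω) := h4 hX
    rw [h3', h4']
    simp only [hp, hq, Pi.zero_apply]
    -- The two displacements weighted by their probabilities cancel.
    ring

/-! ### Sums of bounded martingale differences -/

/-- Bounded random variables that are conditionally centered, each given the past of the (distinct)
time at which it is generated. -/
structure IsMartingaleDifference {Ω J : Type*} [mΩ : MeasurableSpace Ω] (μ : Measure Ω)
    (𝒢 : Filtration ℕ mΩ) (s : Finset J) (T : J → ℕ) (ξ : J → Ω → ℝ) (ε : ℝ) : Prop where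
  inj : Set.InjOn T s
  meas : ∀ p ∈ s, Measurable[𝒢 (T p + 1)] (ξ p)
  bdd : ∀ p ∈ s, ∀ᵐ ω ∂μ, |ξ p ω| ≤ ε
  condExp_eq : ∀ p ∈ s, μ[ξ p|𝒢 (T p)] =ᵐ[μ] 0

section MartingaleDifference

variable {Ω J : Type*} [mΩ : MeasurableSpace Ω] {μ : Measure Ω}
  {𝒢 : Filtration ℕ mΩ} {s : Finset J} {T : J → ℕ} {ξ : J → Ω → ℝ} {ε : ℝ}

namespace IsMartingaleDifference

theorem mono (h : IsMartingaleDifference μ 𝒢 s T ξ ε) {s' : Finset J} (hs : s' ⊆ s) :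
    IsMartingaleDifference μ 𝒢 s' T ξ ε where
  inj := h.inj.mono (by exact_mod_cast hs)
  meas p hp := h.meas p (hs hp)
  bdd p hp := h.bdd p (hs hp)
  condExp_eq p hp := h.condExp_eq p (hs hp)

theorem measurable_sum (h : IsMartingaleDifference μ 𝒢 s T ξ ε) (c : J → ℝ) :
    Measurable fun ω => ∑ p ∈ s, c p * ξ p ω :=
  Finset.measurable_sum _ fun p hp => ((h.meas p hp).mono (𝒢.le _) le_rfl).const_mul _

theorem measurable_sum_of_lt (h : IsMartingaleDifference μ 𝒢 s T ξ ε) (c : J → ℝ) {k : ℕ}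
    (hk : ∀ p ∈ s, T p < k) : Measurable[𝒢 k] fun ω => ∑ p ∈ s, c p * ξ p ω :=
  Finset.measurable_sum _ fun p hp =>
    ((h.meas p hp).mono (𝒢.mono (hk p hp)) le_rfl).const_mul _

theorem ae_abs_sum_le (h : IsMartingaleDifference μ 𝒢 s T ξ ε) (c : J → ℝ) :
    ∀ᵐ ω ∂μ, |∑ p ∈ s, c p * ξ p ω| ≤ ∑ p ∈ s, |c p| * ε := by
  have h1 : ∀ᵐ ω ∂μ, ∀ p ∈ s, |ξ p ω| ≤ ε := (Finset.eventually_all s).2 h.bdd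
  filter_upwards [h1] with ω hω
  refine (Finset.abs_sum_le_sum_abs _ _).trans (Finset.sum_le_sum fun p hp => ?_)
  rw [abs_mul]
  exact mul_le_mul_of_nonneg_left (hω p hp) (abs_nonneg _)

/-- For induction in order of generation: the times are distinct, so a term of maximal time is
strictly later than all the others. -/
theorem lt_of_max [DecidableEq J] {a : J} (h : IsMartingaleDifference μ 𝒢 (insert a s) T ξ ε)
    (ha : a ∉ s) (hmax : ∀ p ∈ s, T p ≤ T a) : ∀ p ∈ s, T p < T a := by
  intro p hp
  refine (hmax p hp).lt_of_ne fun heq => ha ?_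
  rwa [← h.inj (by simp [hp]) (by simp) heq]

end IsMartingaleDifference

variable [IsProbabilityMeasure μ]

theorem integral_mul_eq_zero_of_condExp_eq_zero {m : MeasurableSpace Ω} (hm : m ≤ mΩ)
    {Z Y : Ω → ℝ} (hZ : Measurable[m] Z) (hZY : Integrable (fun ω => Z ω * Y ω) μ)
    (hY : Integrable Y μ) (h : μ[Y|m] =ᵐ[μ] 0) : ∫ ω, Z ω * Y ω ∂μ = 0 := by
  rw [← integral_condExp hm]
  have h1 := condExp_mul_of_stronglyMeasurable_left hZ.stronglyMeasurable hZY hY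
  rw [show (fun ω => Z ω * Y ω) = Z * Y from rfl]
  refine integral_eq_zero_of_ae ?_
  filter_upwards [h1, h] with ω h2 h3
  rw [h2, Pi.mul_apply, h3]
  simp

namespace IsMartingaleDifference

theorem integrable_sum_sq (h : IsMartingaleDifference μ 𝒢 s T ξ ε) (c : J → ℝ) :
    Integrable (fun ω => (∑ p ∈ s, c p * ξ p ω) ^ 2) μ := by
  refine Integrable.of_bound ((h.measurable_sum c).pow_const 2).aestronglyMeasurable
    ((∑ p ∈ s, |c p| * ε) ^ 2) ?_
  filter_upwards [h.ae_abs_sum_le c] with ω hω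
  rw [Real.norm_eq_abs, abs_pow]
  exact pow_le_pow_left₀ (abs_nonneg _) hω 2

theorem integrable_exp_sum (h : IsMartingaleDifference μ 𝒢 s T ξ ε) (c : J → ℝ) :
    Integrable (fun ω => Real.exp (∑ p ∈ s, c p * ξ p ω)) μ := by
  refine Integrable.of_bound (h.measurable_sum c).exp.aestronglyMeasurable
    (Real.exp (∑ p ∈ s, |c p| * ε)) ?_
  filter_upwards [h.ae_abs_sum_le c] with ω hω
  rw [Real.norm_eq_abs, Real.abs_exp]
  exact Real.exp_le_exp.2 ((le_abs_self _).trans hω)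

theorem integrable (h : IsMartingaleDifference μ 𝒢 s T ξ ε) {p : J} (hp : p ∈ s) :
    Integrable (ξ p) μ :=
  Integrable.of_bound ((h.meas p hp).mono (𝒢.le _) le_rfl).aestronglyMeasurable ε (h.bdd p hp)

/-- Peeling off the latest term, the cross term vanishes: the remaining sum is known when the latest
term is generated, and that term is conditionally centered. -/
theorem integral_sum_sq_le (h : IsMartingaleDifference μ 𝒢 s T ξ ε) (c : J → ℝ) :
    ∫ ω, (∑ p ∈ s, c p * ξ p ω) ^ 2 ∂μ ≤ ε ^ 2 * ∑ p ∈ s, c p ^ 2 := by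
  classical
  induction s using Finset.induction_on_max_value T with
  | empty => simp
  | insert a s ha hmax ih =>
    have hs := h.mono (Finset.subset_insert a s)
    have hlt := h.lt_of_max ha hmax
    have has := Finset.mem_insert_self a s
    have hai := h.integrable has
    have hXi : Integrable (fun ω => (∑ p ∈ s, c p * ξ p ω) * ξ a ω) μ :=
      hai.bdd_mul (hs.measurable_sum c).aestronglyMeasurable (hs.ae_abs_sum_le c)
    have hX0 := integral_mul_eq_zero_of_condExp_eq_zero (𝒢.le (T a))
      (hs.measurable_sum_of_lt c hlt) hXi hai (h.condExp_eq a has)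
    have haa : Integrable (fun ω => ξ a ω * ξ a ω) μ :=
      hai.bdd_mul hai.aestronglyMeasurable (h.bdd a has)
    have hsq : ∫ ω, ξ a ω * ξ a ω ∂μ ≤ ε ^ 2 := by
      calc ∫ ω, ξ a ω * ξ a ω ∂μ ≤ ∫ _, ε ^ 2 ∂μ := by
            refine integral_mono_ae haa (integrable_const _) ?_
            filter_upwards [h.bdd a has] with ω hω
            rw [← sq, ← sq_abs]
            exact pow_le_pow_left₀ (abs_nonneg _) hω 2
        _ = ε ^ 2 := by simp
    have hexp : ∀ ω, (∑ p ∈ insert a s, c p * ξ p ω) ^ 2 =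
        c a ^ 2 * (ξ a ω * ξ a ω) + 2 * c a * ((∑ p ∈ s, c p * ξ p ω) * ξ a ω) +
          (∑ p ∈ s, c p * ξ p ω) ^ 2 := by
      intro ω
      rw [Finset.sum_insert ha]
      ring
    simp_rw [hexp]
    rw [integral_add (f := fun ω => c a ^ 2 * (ξ a ω * ξ a ω) +
        2 * c a * ((∑ p ∈ s, c p * ξ p ω) * ξ a ω))
        ((haa.const_mul _).add (hXi.const_mul _)) (hs.integrable_sum_sq c),
      integral_add (haa.const_mul _) (hXi.const_mul _), integral_const_mul, integral_const_mul,
      hX0, Finset.sum_insert ha]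
    have := mul_le_mul_of_nonneg_left hsq (sq_nonneg (c a))
    have := ih hs
    nlinarith

/-- Azuma–Hoeffding. By convexity exp(cξ) ≤ cosh(cε) + (ξ/ε) sinh(cε) for |ξ| ≤ ε. The second term
integrates to zero against the past, and cosh x ≤ exp(x²/2). -/
theorem integral_exp_sum_le (h : IsMartingaleDifference μ 𝒢 s T ξ ε) (hε : 0 ≤ ε) (c : J → ℝ) :
    ∫ ω, Real.exp (∑ p ∈ s, c p * ξ p ω) ∂μ ≤ Real.exp (ε ^ 2 * (∑ p ∈ s, c p ^ 2) / 2) := by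
  classical
  induction s using Finset.induction_on_max_value T with
  | empty => simp
  | insert a s ha hmax ih =>
    have hs := h.mono (Finset.subset_insert a s)
    have hlt := h.lt_of_max ha hmax
    have has := Finset.mem_insert_self a s
    have hai := h.integrable has
    set W : Ω → ℝ := fun ω => Real.exp (∑ p ∈ s, c p * ξ p ω) with hW
    have hWi : Integrable W μ := hs.integrable_exp_sum c
    have hWm : Measurable[𝒢 (T a)] W := (hs.measurable_sum_of_lt c hlt).exp
    have hWa : Integrable (fun ω => W ω * ξ a ω) μ :=
      hWi.mul_bdd hai.aestronglyMeasurable (h.bdd a has)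
    have hWa0 := integral_mul_eq_zero_of_condExp_eq_zero (𝒢.le (T a)) hWm hWa hai
      (h.condExp_eq a has)
    have hW0 : 0 ≤ ∫ ω, W ω ∂μ := integral_nonneg fun ω => (Real.exp_pos _).le
    calc ∫ ω, Real.exp (∑ p ∈ insert a s, c p * ξ p ω) ∂μ
        ≤ ∫ ω, (Real.cosh (c a * ε) * W ω + Real.sinh (c a * ε) / ε * (W ω * ξ a ω)) ∂μ := by
          refine integral_mono_ae (h.integrable_exp_sum c)
            ((hWi.const_mul _).add (hWa.const_mul _)) ?_
          filter_upwards [h.bdd a has] with ω hω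
          rw [Finset.sum_insert ha, Real.exp_add]
          have h1 : c a * ξ a ω = ξ a ω / ε * (c a * ε) := by
            -- For ε = 0 the quotient is 0 by convention, which is harmless since ξ vanishes.
            rcases hε.eq_or_lt with rfl | hε'
            · have : ξ a ω = 0 := by simpa using hω
              simp [this]
            · field_simp
          have h2 : |ξ a ω / ε| ≤ 1 := by
            rw [abs_div, abs_of_nonneg hε]
            exact div_le_one_of_le₀ hω hε
          have h3 : Real.exp (c a * ξ a ω) ≤
              Real.cosh (c a * ε) + ξ a ω / ε * Real.sinh (c a * ε) := by
            rw [h1]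
            exact Real.exp_mul_le_cosh_add_mul_sinh h2 _
          have h4 := mul_le_mul_of_nonneg_right h3 (Real.exp_pos (∑ p ∈ s, c p * ξ p ω)).le
          refine h4.trans (le_of_eq ?_)
          simp only [hW]
          ring
      _ = Real.cosh (c a * ε) * ∫ ω, W ω ∂μ := by
          rw [integral_add (hWi.const_mul _) (hWa.const_mul _), integral_const_mul,
            integral_const_mul, hWa0, mul_zero, add_zero]
      _ ≤ Real.exp ((c a * ε) ^ 2 / 2) * Real.exp (ε ^ 2 * (∑ p ∈ s, c p ^ 2) / 2) :=
          mul_le_mul (Real.cosh_le_exp_half_sq _) (ih hs) hW0 (Real.exp_pos _).le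
      _ = Real.exp (ε ^ 2 * (∑ p ∈ insert a s, c p ^ 2) / 2) := by
          rw [← Real.exp_add, Finset.sum_insert ha]
          congr 1
          ring

end IsMartingaleDifference

/-- The maximal inequality for sub-Gaussian random variables. -/
theorem integral_norm_le_of_subgaussian {ι : Type*} [Fintype ι] [Nonempty ι] {X : Ω → ι → ℝ}
    {σ : ℝ} (hσ : 0 ≤ σ) (hint : Integrable (fun ω => ‖X ω‖) μ)
    (hexp : ∀ θ j, Integrable (fun ω => Real.exp (θ * X ω j)) μ)
    (hmgf : ∀ θ j, ∫ ω, Real.exp (θ * X ω j) ∂μ ≤ Real.exp (θ ^ 2 * σ ^ 2 / 2)) :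
    ∫ ω, ‖X ω‖ ∂μ ≤ σ * √(2 * Real.log (2 * Fintype.card ι)) := by
  set n : ℝ := (Fintype.card ι : ℝ) with hn
  have hn1 : 1 ≤ n := by
    rw [hn]
    exact Nat.one_le_cast.2 Fintype.card_pos
  set L := Real.log (2 * n) with hL
  have hL0 : 0 < L := Real.log_pos (by linarith)
  have key : ∀ θ : ℝ, 0 < θ → θ * ∫ ω, ‖X ω‖ ∂μ ≤ L + θ ^ 2 * σ ^ 2 / 2 := by
    intro θ hθ
    set R := L + θ ^ 2 * σ ^ 2 / 2 with hR
    have hsum : Integrable (fun ω => ∑ j, (Real.exp (θ * X ω j) + Real.exp (-θ * X ω j))) μ :=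
      integrable_finsetSum _ fun j _ => (hexp θ j).add (hexp (-θ) j)
    have hpt : ∀ ω, θ * ‖X ω‖ ≤ R - 1 +
        Real.exp (-R) * ∑ j, (Real.exp (θ * X ω j) + Real.exp (-θ * X ω j)) := by
      intro ω
      have h1 : Real.exp (θ * ‖X ω‖) ≤ ∑ j, (Real.exp (θ * X ω j) + Real.exp (-θ * X ω j)) := by
        obtain ⟨j, -, hj⟩ := Finset.exists_max_image Finset.univ (fun j => ‖X ω j‖)
          Finset.univ_nonempty
        have hle : ‖X ω‖ ≤ |X ω j| :=
          (pi_norm_le_iff_of_nonneg (norm_nonneg _)).2 fun i => hj i (Finset.mem_univ i)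
        refine (Real.exp_le_exp.2 (mul_le_mul_of_nonneg_left hle hθ.le)).trans ?_
        refine le_trans ?_ (Finset.single_le_sum (fun i _ => by positivity) (Finset.mem_univ j))
        rcases abs_cases (X ω j) with ⟨h, -⟩ | ⟨h, -⟩
        · rw [h]
          linarith [Real.exp_pos (-θ * X ω j)]
        · rw [h, mul_neg, ← neg_mul]
          linarith [Real.exp_pos (θ * X ω j)]
      -- The tangent of exp at R, with exp R the bound for the expected sum of exponentials,
      -- replaces Jensen's inequality.
      have h2 := Real.add_one_le_exp (θ * ‖X ω‖ - R)
      rw [sub_eq_add_neg (θ * ‖X ω‖) R, Real.exp_add, mul_comm (Real.exp _)] at h2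
      have h3 := mul_le_mul_of_nonneg_left h1 (Real.exp_pos (-R)).le
      linarith
    have hint2 : ∫ ω, ∑ j, (Real.exp (θ * X ω j) + Real.exp (-θ * X ω j)) ∂μ ≤ Real.exp R := by
      rw [integral_finsetSum _ fun j _ => by exact (hexp θ j).add (hexp (-θ) j)]
      calc _ ≤ ∑ _ : ι, 2 * Real.exp (θ ^ 2 * σ ^ 2 / 2) := by
            refine Finset.sum_le_sum fun j _ => ?_
            rw [integral_add (hexp θ j) (hexp (-θ) j)]
            have h1 := hmgf θ j
            have h2 := hmgf (-θ) j
            rw [neg_sq] at h2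
            linarith
        _ = Real.exp R := by
            rw [hR, Real.exp_add, hL, Real.exp_log (by linarith), Finset.sum_const,
              Finset.card_univ, nsmul_eq_mul]
            ring
    calc θ * ∫ ω, ‖X ω‖ ∂μ = ∫ ω, θ * ‖X ω‖ ∂μ := (integral_const_mul _ _).symm
      _ ≤ ∫ ω, (R - 1 + Real.exp (-R) *
            ∑ j, (Real.exp (θ * X ω j) + Real.exp (-θ * X ω j))) ∂μ :=
          integral_mono (hint.const_mul _) ((integrable_const _).add (hsum.const_mul _)) hpt
      _ = R - 1 + Real.exp (-R) *
            ∫ ω, ∑ j, (Real.exp (θ * X ω j) + Real.exp (-θ * X ω j)) ∂μ := by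
          rw [integral_add (integrable_const _) (hsum.const_mul _), integral_const_mul]
          simp
      _ ≤ R - 1 + Real.exp (-R) * Real.exp R := by gcongr
      _ = R := by rw [← Real.exp_add]; simp
  -- If σ = 0 the optimal θ is infinite, so a large finite θ is used for a contradiction; otherwise
  -- θ = √(2L)/σ is optimal.
  rcases hσ.eq_or_lt with rfl | hσ'
  · by_contra hcon
    rw [zero_mul, not_le] at hcon
    have h1 := key ((L + 1) / ∫ ω, ‖X ω‖ ∂μ) (by positivity)
    rw [div_mul_cancel₀ _ hcon.ne'] at h1
    norm_num at h1
  · set r := √(2 * L) with hr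
    have hr0 : 0 < r := Real.sqrt_pos.2 (by positivity)
    have hr2 : r ^ 2 = 2 * L := Real.sq_sqrt (by positivity)
    have h1 := key (r / σ) (by positivity)
    have h2 : L + (r / σ) ^ 2 * σ ^ 2 / 2 = r / σ * (σ * r) := by
      field_simp
      rw [hr2]
      ring
    rw [h2] at h1
    exact le_of_mul_le_mul_left h1 (by positivity)

end MartingaleDifference

/-! ### The stability function near the origin -/

/-- By Cramer's rule, `∑ Q_j` is a quotient of polynomials both of which are `1` at the origin. -/
theorem RungeKutta.exists_sum_Q_eq_div {s : ℕ} (rk : RungeKutta s) :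
    ∃ P D : ℝ[X], P.eval 0 = 1 ∧ D.eval 0 = 1 ∧
      ∑ j, rk.Q j = algebraMap ℝ[X] (RatFunc ℝ) P / algebraMap ℝ[X] (RatFunc ℝ) D := by
  set M : Matrix (Fin s) (Fin s) ℝ[X] := 1 - (X : ℝ[X]) • rk.a.map C with hM
  have hM0 : (evalRingHom (0 : ℝ)).mapMatrix M = 1 := by
    ext i j
    by_cases hij : i = j <;> simp [hM, Matrix.one_apply, hij]
  have hmap : (1 - (RatFunc.X : RatFunc ℝ) • rk.a.map RatFunc.C) =
      (algebraMap ℝ[X] (RatFunc ℝ)).mapMatrix M := by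
    ext i j
    by_cases hij : i = j <;> simp [hM, hij, mul_comm RatFunc.X]
  have hadj : (evalRingHom (0 : ℝ)).mapMatrix M.adjugate = 1 := by
    rw [RingHom.map_adjugate, hM0, Matrix.adjugate_one]
  have hdet : M.det.eval 0 = 1 := by
    have := RingHom.map_det (evalRingHom (0 : ℝ)) M
    rwa [hM0, Matrix.det_one] at this
  refine ⟨∑ j, ∑ i, C (rk.b i) * M.adjugate i j, M.det, ?_, hdet, ?_⟩
  · have h : ∀ i j, (M.adjugate i j).eval 0 = (1 : Matrix (Fin s) (Fin s) ℝ) i j := by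
      intro i j
      rw [← hadj]
      rfl
    simp only [eval_finsetSum, eval_mul, eval_C, h]
    rw [Finset.sum_comm]
    simp [Matrix.one_apply, rk.consistent]
  · simp only [RungeKutta.Q, hmap]
    rw [Matrix.inv_def, ← RingHom.map_det, ← RingHom.map_adjugate, Ring.inverse_eq_inv']
    simp only [Matrix.smul_apply, RingHom.mapMatrix_apply, Matrix.map_apply, smul_eq_mul, map_sum,
      map_mul, Finset.sum_div, RatFunc.algebraMap_C]
    refine Finset.sum_congr rfl fun j _ => Finset.sum_congr rfl fun i _ => ?_
    rw [div_eq_mul_inv]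
    ring

/-- The expansion `S(z) = 1 + z + O(z²)`, in terms of numerator and denominator. -/
theorem RungeKutta.exists_denom_sub_num {s : ℕ} (rk : RungeKutta s) :
    rk.S.denom.eval 0 ≠ 0 ∧ ∃ w : ℝ[X], rk.S.denom - rk.S.num = -X * w ∧
      w.eval 0 = rk.S.denom.eval 0 := by
  obtain ⟨P, D, hP, hD, hQ⟩ := rk.exists_sum_Q_eq_div
  have hD0 : D ≠ 0 := by
    rintro rfl
    simp at hD
  have hDa : algebraMap ℝ[X] (RatFunc ℝ) D ≠ 0 := by simpa using hD0
  have hS : rk.S = algebraMap ℝ[X] (RatFunc ℝ) (D + X * P) / algebraMap ℝ[X] (RatFunc ℝ) D := by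
    rw [RungeKutta.S, hQ, map_add, map_mul, RatFunc.algebraMap_X, add_div, div_self hDa,
      mul_div_assoc]
  -- The reduced denominator divides `D`, which is 1 at the origin.
  have hne : rk.S.denom.eval 0 ≠ 0 := by
    intro h0
    have hdvd : rk.S.denom ∣ D := by
      rw [hS]
      exact RatFunc.denom_div_dvd _ _
    obtain ⟨q, hq⟩ := hdvd
    rw [hq, eval_mul, h0, zero_mul] at hD
    exact zero_ne_one hD
  have hcross : rk.S.num * D = (D + X * P) * rk.S.denom :=
    (RatFunc.num_mul_eq_mul_denom_iff hD0).2 hS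
  have h0 : (rk.S.denom - rk.S.num).eval 0 = 0 := by
    have := congrArg (eval 0) hcross
    simp [hD] at this
    simp [this]
  obtain ⟨v, hv⟩ := (X_dvd_iff (f := rk.S.denom - rk.S.num)).2 (by rwa [coeff_zero_eq_eval_zero])
  -- Cancelling the factor `X` identifies -v/denom with P/D, whose value at 0 is 1 by consistency.
  have hw : D * (-v) = P * rk.S.denom := by
    apply mul_left_cancel₀ (X_ne_zero (R := ℝ))
    linear_combination D * hv + hcross
  refine ⟨hne, -v, by rw [hv]; ring, ?_⟩
  have := congrArg (eval 0) hw
  rw [eval_mul, eval_mul, hD, hP, one_mul, one_mul] at this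
  exact this

/-- Under the stability assumption, `1 - S(z)²` is at least a multiple of `|z|`. -/
theorem RungeKutta.exists_le_one_sub_S_sq {s : ℕ} (rk : RungeKutta s) (L : ℝ) (hL : 0 ≤ L)
    (hpole : ∀ z : ℝ, z < 0 → rk.S.denom.eval z ≠ 0)
    (hstab : ∀ z : ℝ, -L ≤ z → z < 0 → |rk.S.eval (RingHom.id ℝ) z| < 1) :
    ∃ c > 0, ∀ z : ℝ, -L ≤ z → z < 0 → c * (-z) ≤ 1 - rk.S.eval (RingHom.id ℝ) z ^ 2 := by
  obtain ⟨hne, w, hw, hw0⟩ := rk.exists_denom_sub_num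
  have hden : ∀ z ∈ Set.Icc (-L) 0, rk.S.denom.eval z ≠ 0 := by
    rintro z ⟨-, hz⟩
    rcases hz.lt_or_eq with h | rfl
    exacts [hpole z h, hne]
  -- This is (1 - S²)/(-z) with the singularity at 0 removed, where its value is 2. It is continuous
  -- and positive on the compact interval, and its minimum there is the constant c.
  set q : ℝ → ℝ := fun z => w.eval z * (rk.S.denom.eval z + rk.S.num.eval z) /
    rk.S.denom.eval z ^ 2 with hq
  have hev : ∀ z, rk.S.denom.eval z - rk.S.num.eval z = -z * w.eval z := by
    intro z
    have := congrArg (eval z) hw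
    simpa using this
  have hkey : ∀ z ∈ Set.Icc (-L) 0, 1 - rk.S.eval (RingHom.id ℝ) z ^ 2 = -z * q z := by
    intro z hz
    have h1 := hden z hz
    have h2 := hev z
    simp only [RatFunc.eval, hq, eval₂_id]
    field_simp
    linear_combination (rk.S.denom.eval z + rk.S.num.eval z) * h2
  have hpos : ∀ z ∈ Set.Icc (-L) 0, 0 < q z := by
    intro z hz
    rcases hz.2.lt_or_eq with h | rfl
    · have h1 := hkey z hz
      have h2 : rk.S.eval (RingHom.id ℝ) z ^ 2 < 1 := by
        rw [sq_lt_one_iff_abs_lt_one]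
        exact hstab z hz.1 h
      by_contra hcon
      nlinarith
    · have h1 := hev 0
      have h2 : rk.S.num.eval 0 = rk.S.denom.eval 0 := by linarith
      have h3 : 0 < rk.S.denom.eval 0 ^ 2 := by positivity
      have : q 0 = 2 := by
        simp only [hq, hw0, h2]
        field_simp
        norm_num
      rw [this]
      norm_num
  have hcont : ContinuousOn q (Set.Icc (-L) 0) := by
    refine ContinuousOn.div (by fun_prop) (by fun_prop) fun z hz => ?_
    exact pow_ne_zero _ (hden z hz)
  obtain ⟨x, hx, hmin⟩ := isCompact_Icc.exists_isMinOn ⟨0, by simpa using hL⟩ hcont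
  refine ⟨q x, hpos x hx, fun z hz1 hz2 => ?_⟩
  have hz : z ∈ Set.Icc (-L) 0 := ⟨hz1, hz2.le⟩
  rw [hkey z hz, mul_comm]
  exact mul_le_mul_of_nonneg_left (hmin hz) (by linarith)

/-! ### Lattice sums -/

theorem sum_inv_sq_le (n : ℕ) : ∑ i ∈ Finset.range n, (((i : ℝ) + 1) ^ 2)⁻¹ ≤ 2 := by
  have h : ∀ n : ℕ, ∑ i ∈ Finset.range n, (((i : ℝ) + 1) ^ 2)⁻¹ ≤ 2 * (1 - ((n : ℝ) + 1)⁻¹) := by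
    intro n
    induction n with
    | zero => simp
    | succ n ih =>
      rw [Finset.sum_range_succ]
      have : (((n : ℝ) + 1) ^ 2)⁻¹ ≤ 2 * (((n : ℝ) + 1)⁻¹ - ((n : ℝ) + 1 + 1)⁻¹) := by
        rw [inv_sub_inv (by positivity) (by positivity), ← mul_div_assoc, inv_eq_one_div,
          div_le_div_iff₀ (by positivity) (by positivity)]
        have : (0 : ℝ) ≤ n := by positivity
        nlinarith
      push_cast
      linarith
  have := h n
  have h2 : (0 : ℝ) ≤ ((n : ℝ) + 1)⁻¹ := by positivity
  linarith

/-- With m = i + 1, (r+m)² ≤ 2(r²+m²) bounds the terms by a telescoping sum. -/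
theorem sum_inv_add_sq_le (r : ℝ) (hr : 0 < r) (n : ℕ) :
    ∑ i ∈ Finset.range n, (r ^ 2 + ((i : ℝ) + 1) ^ 2)⁻¹ ≤ 2 * r⁻¹ := by
  have h : ∀ n : ℕ, ∑ i ∈ Finset.range n, (r ^ 2 + ((i : ℝ) + 1) ^ 2)⁻¹ ≤
      2 * (r⁻¹ - ((n : ℝ) + r)⁻¹) := by
    intro n
    induction n with
    | zero => simp
    | succ n ih =>
      rw [Finset.sum_range_succ]
      have : (r ^ 2 + ((n : ℝ) + 1) ^ 2)⁻¹ ≤ 2 * (((n : ℝ) + r)⁻¹ - ((n : ℝ) + 1 + r)⁻¹) := by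
        rw [inv_sub_inv (by positivity) (by positivity), ← mul_div_assoc, inv_eq_one_div,
          div_le_div_iff₀ (by positivity) (by positivity)]
        have : (0 : ℝ) ≤ n := by positivity
        nlinarith [sq_nonneg ((n : ℝ) + 1 - r)]
      push_cast
      linarith
  have := h n
  have h2 : (0 : ℝ) ≤ ((n : ℝ) + r)⁻¹ := by positivity
  linarith

theorem sum_inv_sq_add_sq_le (n : ℕ) :
    ∑ i ∈ Finset.range n, ∑ j ∈ Finset.range n, (((i : ℝ) + 1) ^ 2 + ((j : ℝ) + 1) ^ 2)⁻¹ ≤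
      6 * Real.log (n + 1) := by
  rcases Nat.eq_zero_or_pos n with rfl | hn
  · simp
  have h1 : ∑ i ∈ Finset.range n, ∑ j ∈ Finset.range n,
      (((i : ℝ) + 1) ^ 2 + ((j : ℝ) + 1) ^ 2)⁻¹ ≤ ∑ i ∈ Finset.range n, 2 * ((i : ℝ) + 1)⁻¹ :=
    Finset.sum_le_sum fun i _ => sum_inv_add_sq_le _ (by positivity) n
  have h2 : ∑ i ∈ Finset.range n, ((i : ℝ) + 1)⁻¹ ≤ 1 + Real.log n := by
    have := harmonic_le_one_add_log n
    simpa [harmonic] using this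
  have hn' : (1 : ℝ) ≤ n := by exact_mod_cast hn
  have h3 : Real.log n ≤ Real.log (n + 1) := Real.log_le_log (by linarith) (by linarith)
  have h4 : Real.log 2 ≤ Real.log (n + 1) := Real.log_le_log (by norm_num) (by linarith)
  -- The additive 2 in 2(1 + log n) is absorbed by 4 log(n+1), as log 2 > 1/2.
  have h5 := Real.log_two_gt_d9
  rw [← Finset.mul_sum] at h1
  linarith

/-- Telescoping: consecutive cube roots y ≤ x satisfy 1 = x³ - y³ ≤ 3x²(x - y). -/
theorem sum_inv_cbrt_sq_le (n : ℕ) :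
    ∑ i ∈ Finset.range n, ((((i : ℝ) + 1) ^ (1 / 3 : ℝ)) ^ 2)⁻¹ ≤ 3 * (n : ℝ) ^ (1 / 3 : ℝ) := by
  have cube : ∀ x : ℝ, 0 ≤ x → (x ^ (1 / 3 : ℝ)) ^ 3 = x := by
    intro x hx
    rw [← Real.rpow_natCast, ← Real.rpow_mul hx]
    norm_num
  induction n with
  | zero => simp
  | succ n ih =>
    rw [Finset.sum_range_succ]
    push_cast
    have hx := cube ((n : ℝ) + 1) (by positivity)
    have hy := cube (n : ℝ) (by positivity)
    have hx0 : 0 < ((n : ℝ) + 1) ^ (1 / 3 : ℝ) := by positivity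
    have hy0 : 0 ≤ (n : ℝ) ^ (1 / 3 : ℝ) := by positivity
    have hxy : (n : ℝ) ^ (1 / 3 : ℝ) ≤ ((n : ℝ) + 1) ^ (1 / 3 : ℝ) :=
      Real.rpow_le_rpow (by positivity) (by linarith) (by norm_num)
    generalize ((n : ℝ) + 1) ^ (1 / 3 : ℝ) = x at *
    generalize (n : ℝ) ^ (1 / 3 : ℝ) = y at *
    have : (x ^ 2)⁻¹ ≤ 3 * (x - y) := by
      rw [inv_eq_one_div, div_le_iff₀ (by positivity)]
      have h1 : 1 = (x - y) * (x ^ 2 + x * y + y ^ 2) := by linarith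
      have h2 : x ^ 2 + x * y + y ^ 2 ≤ 3 * x ^ 2 := by nlinarith
      have h3 := mul_le_mul_of_nonneg_left h2 (sub_nonneg.2 hxy)
      linarith
    linarith

/-- AM–GM bounds |k|⁻² by a third of the product of the k_l^(-2/3), so the triple sum factors into
the cube of a one-dimensional sum. -/
theorem sum_inv_sq_add_sq_add_sq_le (n : ℕ) :
    ∑ k : Fin 3 → Fin n, (∑ l, (((k l : ℕ) : ℝ) + 1) ^ 2)⁻¹ ≤ 9 * (n : ℝ) := by
  have h1 : ∀ k : Fin 3 → Fin n, (∑ l, (((k l : ℕ) : ℝ) + 1) ^ 2)⁻¹ ≤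
      3⁻¹ * ∏ l, (((((k l : ℕ) : ℝ) + 1) ^ (1 / 3 : ℝ)) ^ 2)⁻¹ := by
    intro k
    have six : ∀ x : ℝ, 0 ≤ x → x ^ 2 = ((x ^ (1 / 3 : ℝ)) ^ 2) ^ 3 := by
      intro x hx
      rw [← Real.rpow_natCast _ 2, ← Real.rpow_natCast _ 2, ← Real.rpow_natCast _ 3,
        ← Real.rpow_mul hx, ← Real.rpow_mul hx]
      norm_num
    rw [Finset.prod_inv_distrib, ← mul_inv]
    apply inv_anti₀ (by positivity)
    rw [Finset.sum_congr rfl fun l _ => six (((k l : ℕ) : ℝ) + 1) (by positivity)]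
    simp only [Fin.sum_univ_three, Fin.prod_univ_three]
    have p : ∀ l, 0 < ((((k l : ℕ) : ℝ) + 1) ^ (1 / 3 : ℝ)) ^ 2 := fun l => by positivity
    have p0 := p 0
    have p1 := p 1
    have p2 := p 2
    generalize ((((k 0 : ℕ) : ℝ) + 1) ^ (1 / 3 : ℝ)) ^ 2 = x at *
    generalize ((((k 1 : ℕ) : ℝ) + 1) ^ (1 / 3 : ℝ)) ^ 2 = y at *
    generalize ((((k 2 : ℕ) : ℝ) + 1) ^ (1 / 3 : ℝ)) ^ 2 = z at *
    have : x ^ 3 + y ^ 3 + z ^ 3 - 3 * (x * y * z) =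
      (x + y + z) * ((x - y) ^ 2 + (y - z) ^ 2 + (x - z) ^ 2) / 2 := by ring
    have : 0 ≤ (x + y + z) * ((x - y) ^ 2 + (y - z) ^ 2 + (x - z) ^ 2) / 2 := by positivity
    linarith
  refine (Finset.sum_le_sum fun k _ => h1 k).trans ?_
  rw [← Finset.mul_sum]
  have h2 := Fintype.prod_sum (fun (_ : Fin 3) (i : Fin n) =>
    (((((i : ℕ) : ℝ) + 1) ^ (1 / 3 : ℝ)) ^ 2)⁻¹)
  rw [← h2, Finset.prod_const, Finset.card_univ, Fintype.card_fin,
    Fin.sum_univ_eq_sum_range (fun i => ((((i : ℝ) + 1) ^ (1 / 3 : ℝ)) ^ 2)⁻¹)]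
  have h3 := pow_le_pow_left₀ (Finset.sum_nonneg fun i _ => by positivity) (sum_inv_cbrt_sq_le n) 3
  have h4 : ((n : ℝ) ^ (1 / 3 : ℝ)) ^ 3 = n := by
    rw [← Real.rpow_natCast, ← Real.rpow_mul (by positivity)]
    norm_num
  rw [mul_pow, h4] at h3
  linarith

theorem ell_eq {lam : ℝ} (hlam : 0 < lam) {K : ℕ} (hK : 1 ≤ K) :
    ell lam (lam / (K : ℝ) ^ 2) = 2 * Real.log K := by
  have hK' : (0 : ℝ) < K := by exact_mod_cast hK
  have h1 : lam⁻¹ * (lam / (K : ℝ) ^ 2) = ((K : ℝ) ^ 2)⁻¹ := by field_simp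
  have h0 : 0 ≤ Real.log K := Real.log_nonneg (by exact_mod_cast hK)
  rw [ell, h1, Real.log_inv, Real.log_pow, abs_neg, abs_of_nonneg (by positivity)]
  norm_num

/-- Lattice sums over the frequencies of the discrete Laplacian grow like `φ_d`. -/
theorem exists_lattice_sum_le_phi (d : ℕ) (hd : d = 1 ∨ d = 2 ∨ d = 3) (lam : ℝ) (hlam : 0 < lam) :
    ∃ C > 0, ∀ K : ℕ, 1 ≤ K →
      (K : ℝ) ^ 2 * ∑ k : GridIndex d K, (∑ l, (((k l : ℕ) : ℝ) + 1) ^ 2)⁻¹ ≤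
        phi d C lam (lam / K ^ 2) := by
  rcases hd with rfl | rfl | rfl
  · refine ⟨2 * lam, by positivity, fun K hK => ?_⟩
    have h1 : ∑ k : GridIndex 1 K, (∑ l, (((k l : ℕ) : ℝ) + 1) ^ 2)⁻¹ ≤ 2 := by
      rw [← (Equiv.funUnique (Fin 1) (Fin (K - 1))).symm.sum_comp]
      simp only [Fin.sum_univ_one, Equiv.funUnique_symm_apply, uniqueElim_const]
      rw [Fin.sum_univ_eq_sum_range (fun i => (((i : ℝ) + 1) ^ 2)⁻¹)]
      exact sum_inv_sq_le _
    have hK' : (0 : ℝ) < K := by exact_mod_cast hK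
    calc _ ≤ (K : ℝ) ^ 2 * 2 := by gcongr
      _ = _ := by
        simp only [phi]
        field_simp
  · refine ⟨3 * lam, by positivity, fun K hK => ?_⟩
    have hK' : (0 : ℝ) < K := by exact_mod_cast hK
    have h1 : ∑ k : GridIndex 2 K, (∑ l, (((k l : ℕ) : ℝ) + 1) ^ 2)⁻¹ ≤ 6 * Real.log K := by
      rw [← (finTwoArrowEquiv (Fin (K - 1))).symm.sum_comp, Fintype.sum_prod_type]
      simp only [Fin.sum_univ_two, finTwoArrowEquiv_symm_apply, Matrix.cons_val_zero,
        Matrix.cons_val_one]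
      have := sum_inv_sq_add_sq_le (K - 1)
      rw [Nat.cast_sub hK, Nat.cast_one, sub_add_cancel] at this
      refine le_trans (le_of_eq ?_) this
      rw [← Fin.sum_univ_eq_sum_range (fun i => ∑ j ∈ Finset.range (K - 1),
        (((i : ℝ) + 1) ^ 2 + ((j : ℝ) + 1) ^ 2)⁻¹)]
      refine Finset.sum_congr rfl fun i _ => ?_
      rw [← Fin.sum_univ_eq_sum_range (fun j => ((((i : ℕ) : ℝ) + 1) ^ 2 + ((j : ℝ) + 1) ^ 2)⁻¹)]
    have h2 := ell_eq hlam hK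
    calc _ ≤ (K : ℝ) ^ 2 * (6 * Real.log K) := by gcongr
      _ = _ := by
        simp only [phi, h2]
        field_simp
        ring
  · refine ⟨9 * lam ^ (3 / 2 : ℝ), by positivity, fun K hK => ?_⟩
    have hK' : (0 : ℝ) < K := by exact_mod_cast hK
    have h1 := sum_inv_sq_add_sq_add_sq_le (K - 1)
    rw [Nat.cast_sub hK] at h1
    have h2 : (lam / (K : ℝ) ^ 2) ^ (-(3 / 2) : ℝ) = (lam ^ (3 / 2 : ℝ))⁻¹ * (K : ℝ) ^ 3 := by
      rw [Real.div_rpow hlam.le (by positivity), Real.rpow_neg hlam.le, Real.rpow_neg (by positivity),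
        ← Real.rpow_natCast (K : ℝ) 2, ← Real.rpow_mul hK'.le, div_inv_eq_mul]
      norm_num
    calc _ ≤ (K : ℝ) ^ 2 * (9 * K) := by
          gcongr
          refine h1.trans ?_
          simp
      _ = _ := by
        simp only [phi, h2]
        have : 0 < lam ^ (3 / 2 : ℝ) := by positivity
        field_simp

/-! ### Diagonalization of the finite difference Laplacian -/

noncomputable section

/-- Entry of the (unnormalized) discrete sine transform. -/
def sineEntry (K : ℕ) (a b : ℕ) : ℝ := Real.sin ((a + 1) * (b + 1) * (Real.pi / K))

/-- The eigenvalues of the second difference matrix. -/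
def secondDiffEigenvalue (K : ℕ) (b : ℕ) : ℝ := 4 * Real.sin ((b + 1) * Real.pi / (2 * K)) ^ 2

/-- The orthonormal eigenvectors of the finite difference Laplacian. -/
def sineMatrix (d K : ℕ) : Matrix (GridIndex d K) (GridIndex d K) ℝ :=
  fun i p => ∏ l, (√(2 / K) * sineEntry K (i l) (p l))

end

theorem secondDiffEigenvalue_eq (K b : ℕ) :
    secondDiffEigenvalue K b = 2 - 2 * Real.cos ((b + 1) * (Real.pi / K)) := by
  have : ((b : ℝ) + 1) * (Real.pi / K) = 2 * ((b + 1) * Real.pi / (2 * K)) := by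
    rcases Nat.eq_zero_or_pos K with rfl | hK
    · simp
    · field_simp
  rw [secondDiffEigenvalue, this, Real.cos_two_mul, Real.cos_sq']
  ring

/-- The sequence is extended to ℕ so that `v n = 0` encodes the right boundary condition; the left
boundary would have index -1 and needs the case distinction. -/
theorem sum_secondDiff_mul (n : ℕ) (i : Fin n) (v : ℕ → ℝ) (hn : v n = 0) :
    ∑ j : Fin n, secondDiff n i j * v j =
      2 * v i - v (i + 1) - if (i : ℕ) = 0 then 0 else v (i - 1) := by
  have h1 : ∀ j : Fin n, secondDiff n i j * v j = (if (j : ℕ) = i then 2 * v i else 0) -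
      (if (j : ℕ) = i + 1 then v (i + 1) else 0) -
      (if (j : ℕ) + 1 = i then v (i - 1) else 0) := by
    intro j
    simp only [secondDiff, Fin.ext_iff]
    split_ifs with h1 h2 h3 h4 h5 h6 h7 h8 h9 h10 <;>
      first
      | omega
      | skip
    · rw [h1]; ring
    all_goals first
      | (rw [show (j : ℕ) = i + 1 by omega]; ring)
      | (rw [show (j : ℕ) = i - 1 by omega]; ring)
      | ring
  simp_rw [h1, Finset.sum_sub_distrib]
  rw [Fin.sum_univ_eq_sum_range (fun j => if j = (i : ℕ) then 2 * v i else 0),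
    Fin.sum_univ_eq_sum_range (fun j => if j = (i : ℕ) + 1 then v (i + 1) else 0),
    Fin.sum_univ_eq_sum_range (fun j => if j + 1 = (i : ℕ) then v (i - 1) else 0)]
  have hi := i.2
  congr 1
  · congr 1
    · simp
    · rw [Finset.sum_ite_eq']
      split_ifs with h
      · rfl
      · rw [Finset.mem_range] at h
        rw [show (i : ℕ) + 1 = n by omega, hn]
  · split_ifs with h
    · exact Finset.sum_eq_zero fun j _ => if_neg (by omega)
    · rw [Finset.sum_eq_single ((i : ℕ) - 1)]
      · rw [if_pos (by omega)]
      · intro j _ hj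
        exact if_neg (by omega)
      · intro hj
        rw [Finset.mem_range] at hj
        omega

/-- The identity sin(x+y) + sin(x-y) = 2 sin x cos y; the sine vanishes at both boundary points. -/
theorem sum_secondDiff_mul_sineEntry (K : ℕ) (hK : 1 ≤ K) (a b : Fin (K - 1)) :
    ∑ j : Fin (K - 1), secondDiff (K - 1) a j * sineEntry K j b =
      secondDiffEigenvalue K b * sineEntry K a b := by
  have hK0 : (K : ℝ) ≠ 0 := by
    have : (0 : ℝ) < K := by exact_mod_cast hK
    exact this.ne'
  rw [sum_secondDiff_mul (K - 1) a (fun j => sineEntry K j b), secondDiffEigenvalue_eq]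
  · have h1 : (if ((a : ℕ)) = 0 then 0 else sineEntry K (a - 1) b) =
        Real.sin (((a : ℕ) : ℝ) * ((b : ℕ) + 1) * (Real.pi / K)) := by
      split_ifs with h
      · simp [h]
      · rw [sineEntry, Nat.cast_sub (by omega)]
        simp
    rw [h1]
    simp only [sineEntry]
    set x : ℝ := ((a : ℕ) + 1) * ((b : ℕ) + 1) * (Real.pi / K) with hx
    set y : ℝ := ((b : ℕ) + 1) * (Real.pi / K) with hy
    rw [show ((a : ℕ) : ℝ) * ((b : ℕ) + 1) * (Real.pi / K) = x - y by rw [hx, hy]; ring,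
      show (((a : ℕ) + 1 : ℕ) + 1 : ℝ) * ((b : ℕ) + 1) * (Real.pi / K) = x + y by
        rw [hx, hy]; push_cast; ring, Real.sin_add, Real.sin_sub]
    ring
  · simp only [sineEntry]
    rw [Nat.cast_sub hK, Nat.cast_one, sub_add_cancel,
      show (K : ℝ) * ((b : ℕ) + 1) * (Real.pi / K) = ((b + 1 : ℕ) : ℝ) * Real.pi by
        push_cast; field_simp]
    exact Real.sin_nat_mul_pi _

/-- Real part of the sum of all powers of a K-th root of unity, which differs from 1 because 0 < a <
K. -/
theorem sum_cos_eq_zero (K a : ℕ) (ha : 0 < a) (haK : a < K) :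
    ∑ b ∈ Finset.range K, Real.cos (b * (2 * (a * (Real.pi / K)))) = 0 := by
  set ζ : ℂ := Complex.exp ((2 * (a * (Real.pi / K)) : ℝ) * Complex.I) with hζ
  have hK0 : (K : ℝ) ≠ 0 := by
    have : (0 : ℝ) < K := by exact_mod_cast ha.trans haK
    exact this.ne'
  have h1 : ζ ^ K = 1 := by
    rw [hζ, ← Complex.exp_nat_mul, Complex.exp_eq_one_iff]
    refine ⟨a, ?_⟩
    have : (K : ℂ) ≠ 0 := by exact_mod_cast hK0
    push_cast
    field_simp
  have h2 : ζ ≠ 1 := by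
    intro h
    have h3 := congrArg Complex.re h
    rw [hζ, Complex.exp_ofReal_mul_I_re, Complex.one_re, Real.cos_two_mul, Real.cos_sq'] at h3
    have hpos : 0 < Real.sin (a * (Real.pi / K)) := by
      have ha' : (0 : ℝ) < a := by exact_mod_cast ha
      have hK' : (0 : ℝ) < K := by exact_mod_cast ha.trans haK
      have haK' : (a : ℝ) < K := by exact_mod_cast haK
      have := Real.pi_pos
      apply Real.sin_pos_of_pos_of_lt_pi (by positivity)
      rw [mul_div_left_comm]
      exact mul_lt_of_lt_one_right this ((div_lt_one hK').2 haK')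
    nlinarith
  have h3 : ∑ b ∈ Finset.range K, ζ ^ b = 0 := by
    have := geom_sum_mul ζ K
    rw [h1, sub_self] at this
    exact (mul_eq_zero.1 this).resolve_right (sub_ne_zero.2 h2)
  have h4 := congrArg Complex.re h3
  rw [Complex.re_sum, Complex.zero_re] at h4
  rw [← h4]
  refine Finset.sum_congr rfl fun b _ => ?_
  rw [hζ, ← Complex.exp_nat_mul, ← Complex.exp_ofReal_mul_I_re]
  push_cast
  rw [mul_assoc (b : ℂ)]

theorem sum_sineEntry_sq (K : ℕ) (a : Fin (K - 1)) :
    ∑ b : Fin (K - 1), sineEntry K b a ^ 2 = K / 2 := by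
  have ha := a.2
  have hK : K = K - 1 + 1 := by omega
  have h1 : ∀ b : ℕ, Real.sin (b * (((a : ℕ) + 1) * (Real.pi / K))) ^ 2 =
      1 / 2 - Real.cos (b * (2 * (((a + 1 : ℕ) : ℝ) * (Real.pi / K)))) / 2 := by
    intro b
    rw [Real.sin_sq_eq_half_sub]
    congr 3
    push_cast
    ring
  have h2 : ∑ b ∈ Finset.range K, Real.sin (b * (((a : ℕ) + 1) * (Real.pi / K))) ^ 2 = K / 2 := by
    rw [Finset.sum_congr rfl fun b _ => h1 b, Finset.sum_sub_distrib, ← Finset.sum_div, ← Finset.sum_div,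
      sum_cos_eq_zero K (a + 1) (by omega) (by omega)]
    simp [div_eq_mul_inv]
  rw [← h2]
  have h3 := Finset.sum_range_succ'
    (fun b : ℕ => Real.sin (b * (((a : ℕ) + 1) * (Real.pi / K))) ^ 2) (K - 1)
  rw [← hK] at h3
  rw [h3, Fin.sum_univ_eq_sum_range (fun b => sineEntry K b a ^ 2)]
  simp only [sineEntry, Nat.cast_add, Nat.cast_one, Nat.cast_zero, zero_mul, Real.sin_zero]
  rw [zero_pow two_ne_zero, add_zero]
  refine Finset.sum_congr rfl fun b _ => ?_
  rw [mul_assoc]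

theorem secondDiffEigenvalue_injective (K : ℕ) :
    Function.Injective fun b : Fin (K - 1) => secondDiffEigenvalue K b := by
  intro a b hab
  have ha := a.2
  have hK' : (0 : ℝ) < K := by
    have : 0 < K := by omega
    exact_mod_cast this
  simp only [secondDiffEigenvalue_eq] at hab
  have hmem : ∀ c : Fin (K - 1), ((c : ℕ) + 1 : ℝ) * (Real.pi / K) ∈ Set.Icc 0 Real.pi := by
    intro c
    have hc : ((c : ℕ) + 1 : ℝ) ≤ K := by
      have := c.2
      have : (c : ℕ) + 1 ≤ K := by omega
      exact_mod_cast this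
    have := Real.pi_pos
    refine ⟨by positivity, ?_⟩
    rw [mul_div_left_comm]
    exact mul_le_of_le_one_right this.le ((div_le_one hK').2 hc)
  have h := Real.injOn_cos (hmem a) (hmem b) (by linarith)
  have hne : Real.pi / (K : ℝ) ≠ 0 := by
    have := Real.pi_pos
    positivity
  have h2 := mul_right_cancel₀ hne h
  have h3 : ((a : ℕ) : ℝ) = (b : ℕ) := by linarith
  exact Fin.ext (by exact_mod_cast h3)

theorem secondDiff_symm (n : ℕ) (i j : Fin n) : secondDiff n i j = secondDiff n j i := by
  simp only [secondDiff, eq_comm (a := i), or_comm]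

/-- Off the diagonal, eigenvectors of a symmetric matrix with distinct eigenvalues are orthogonal.
-/
theorem sum_sineEntry_mul (K : ℕ) (a b : Fin (K - 1)) :
    ∑ j : Fin (K - 1), sineEntry K j a * sineEntry K j b = if a = b then (K : ℝ) / 2 else 0 := by
  have hK : 1 ≤ K := by
    have := a.2
    omega
  split_ifs with hab
  · subst hab
    simp_rw [← sq]
    exact sum_sineEntry_sq K a
  · have h1 : secondDiffEigenvalue K a * ∑ j : Fin (K - 1), sineEntry K j a * sineEntry K j b =
        secondDiffEigenvalue K b * ∑ j : Fin (K - 1), sineEntry K j a * sineEntry K j b := by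
      rw [Finset.mul_sum, Finset.mul_sum]
      calc _ = ∑ j, ∑ i, secondDiff (K - 1) j i * sineEntry K i a * sineEntry K j b := by
            refine Finset.sum_congr rfl fun j _ => ?_
            rw [← mul_assoc, ← sum_secondDiff_mul_sineEntry K hK, Finset.sum_mul]
        _ = ∑ i, ∑ j, secondDiff (K - 1) j i * sineEntry K i a * sineEntry K j b :=
            Finset.sum_comm
        _ = _ := by
            refine Finset.sum_congr rfl fun j _ => ?_
            rw [mul_left_comm, ← sum_secondDiff_mul_sineEntry K hK, Finset.mul_sum]
            refine Finset.sum_congr rfl fun i _ => ?_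
            rw [secondDiff_symm]
            ring
    by_contra hne
    exact hab (secondDiffEigenvalue_injective K (mul_right_cancel₀ hne h1))

theorem sineMatrix_symm (d K : ℕ) (i p : GridIndex d K) : sineMatrix d K i p = sineMatrix d K p i := by
  simp only [sineMatrix, sineEntry]
  refine Finset.prod_congr rfl fun l _ => ?_
  congr 2
  ring

theorem sineMatrix_mul_self (d K : ℕ) : sineMatrix d K * sineMatrix d K = 1 := by
  ext i p
  rw [Matrix.mul_apply]
  simp_rw [sineMatrix_symm d K i, sineMatrix, ← Finset.prod_mul_distrib]
  rw [← Fintype.prod_sum (fun (l : Fin d) (j : Fin (K - 1)) =>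
    √(2 / K) * sineEntry K j (i l) * (√(2 / K) * sineEntry K j (p l)))]
  have h1 : ∀ l, ∑ j : Fin (K - 1),
      √(2 / K) * sineEntry K j (i l) * (√(2 / K) * sineEntry K j (p l)) =
        if i l = p l then 1 else 0 := by
    intro l
    have hK : (0 : ℝ) < K := by
      have := (i l).2
      have : 0 < K := by omega
      exact_mod_cast this
    have h2 : ∀ j : Fin (K - 1),
        √(2 / K) * sineEntry K j (i l) * (√(2 / K) * sineEntry K j (p l)) =
          2 / K * (sineEntry K j (i l) * sineEntry K j (p l)) := by
      intro j
      have := Real.mul_self_sqrt (show (0 : ℝ) ≤ 2 / K by positivity)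
      linear_combination (sineEntry K j (i l) * sineEntry K j (p l)) * this
    simp_rw [h2, ← Finset.mul_sum, sum_sineEntry_mul]
    split_ifs
    · field_simp
    · simp
  simp_rw [h1, Matrix.one_apply]
  split_ifs with hip
  · simp [hip]
  · obtain ⟨l, hl⟩ := Function.ne_iff.1 hip
    exact Finset.prod_eq_zero (Finset.mem_univ l) (if_neg hl)

/-- The eigenvectors are spread out over the grid, so no entry's variance exceeds the mean bound by
more than a factor 2^d. -/
theorem sineMatrix_sq_le (d K : ℕ) (i p : GridIndex d K) :
    sineMatrix d K i p ^ 2 ≤ (2 / K) ^ d := by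
  rw [sineMatrix, ← Finset.prod_pow]
  calc _ ≤ ∏ _ : Fin d, (2 / K : ℝ) := by
        refine Finset.prod_le_prod (fun l _ => sq_nonneg _) fun l _ => ?_
        rw [mul_pow, Real.sq_sqrt (by positivity)]
        exact mul_le_of_le_one_right (by positivity) (Real.sin_sq_le_one _)
    _ = _ := by rw [Finset.prod_const, Finset.card_univ, Fintype.card_fin]

theorem fdLaplacian_mul_sineMatrix (d K : ℕ) (hK : 1 ≤ K) (i p : GridIndex d K) :
    ∑ j, fdLaplacian d K i j * sineMatrix d K j p =
      (K : ℝ) ^ 2 * (∑ l, secondDiffEigenvalue K (p l)) * sineMatrix d K i p := by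
  simp_rw [fdLaplacian, mul_assoc, ← Finset.mul_sum, Finset.sum_mul]
  congr 1
  rw [Finset.sum_comm]
  refine Finset.sum_congr rfl fun l _ => ?_
  have h1 : ∑ j : GridIndex d K,
      (if ∀ m, m ≠ l → i m = j m then secondDiff (K - 1) (i l) (j l) else 0) * sineMatrix d K j p =
      ∑ c : Fin (K - 1), secondDiff (K - 1) (i l) c * sineMatrix d K (Function.update i l c) p := by
    symm
    -- Only the grid points on the line through `i` in direction `l` contribute; the other sine
    -- factors are constant along it.
    refine Finset.sum_of_injOn (fun c => Function.update i l c)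
      (fun a _ b _ h => Function.update_injective i l h) (by simp) ?_ ?_
    · intro j _ hj
      rw [if_neg, zero_mul]
      intro hcon
      refine hj ⟨j l, by simp, ?_⟩
      funext m
      by_cases hm : m = l
      · subst hm
        simp
      · simp [hm, hcon m hm]
    · intro c _
      rw [if_pos, Function.update_self]
      intro m hm
      rw [Function.update_of_ne hm]
  have h2 : ∀ c, sineMatrix d K (Function.update i l c) p =
      (√(2 / K) * ∏ m ∈ Finset.univ.erase l, (√(2 / K) * sineEntry K (i m) (p m))) *
        sineEntry K c (p l) := by
    intro c
    rw [sineMatrix, ← Finset.mul_prod_erase _ _ (Finset.mem_univ l), Function.update_self,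
      Finset.prod_congr rfl fun m hm => by rw [Function.update_of_ne (Finset.ne_of_mem_erase hm)]]
    ring
  have h3 : sineMatrix d K i p =
      (√(2 / K) * ∏ m ∈ Finset.univ.erase l, (√(2 / K) * sineEntry K (i m) (p m))) *
        sineEntry K (i l) (p l) := by
    rw [← h2, Function.update_eq_self]
  rw [h1, h3]
  simp_rw [h2, mul_left_comm (secondDiff _ _ _), ← Finset.mul_sum,
    sum_secondDiff_mul_sineEntry K hK]
  ring

/-! ### Functions of diagonalized matrices -/

section Diagonalization

variable {ι : Type*} [Fintype ι] [DecidableEq ι] {W B : Matrix ι ι ℝ} {z : ι → ℝ}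

theorem aeval_eq_of_diagonalization (hW : W * W = 1) (hB : B * W = W * Matrix.diagonal z)
    (p : ℝ[X]) : aeval B p = W * Matrix.diagonal (fun k => p.eval (z k)) * W := by
  have hB' : B = W * Matrix.diagonal z * W := by rw [← hB, mul_assoc, hW, mul_one]
  induction p using Polynomial.induction_on' with
  | add p q hp hq =>
    rw [map_add, hp, hq, ← add_mul, ← mul_add, Matrix.diagonal_add]
    simp
  | monomial n a =>
    have hpow : B ^ n = W * Matrix.diagonal (fun k => z k ^ n) * W := by
      induction n with
      | zero => simp [hW]
      | succ n ih =>
        rw [pow_succ, ih]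
        conv_lhs => rw [hB']
        calc _ = W * Matrix.diagonal (fun k => z k ^ n) * (W * W) * Matrix.diagonal z * W := by
              noncomm_ring
          _ = _ := by
              rw [hW, mul_one, mul_assoc W, Matrix.diagonal_mul_diagonal]
              simp [pow_succ]
    rw [aeval_monomial, hpow, ← Algebra.smul_def]
    simp only [eval_monomial]
    rw [← Matrix.smul_mul, ← Matrix.mul_smul]
    congr 2
    ext i j
    by_cases hij : i = j <;> simp [hij]

theorem ratMatrix_eq_of_diagonalization (hW : W * W = 1) (hB : B * W = W * Matrix.diagonal z)
    (P : RatFunc ℝ) (hP : ∀ k, P.denom.eval (z k) ≠ 0) :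
    ratMatrix P B = W * Matrix.diagonal (fun k => P.eval (RingHom.id ℝ) (z k)) * W := by
  have hinv : (aeval B P.denom)⁻¹ =
      W * Matrix.diagonal (fun k => (P.denom.eval (z k))⁻¹) * W := by
    apply Matrix.inv_eq_right_inv
    rw [aeval_eq_of_diagonalization hW hB]
    calc _ = W * Matrix.diagonal (fun k => P.denom.eval (z k)) * (W * W) *
          Matrix.diagonal (fun k => (P.denom.eval (z k))⁻¹) * W := by noncomm_ring
      _ = 1 := by
        rw [hW, mul_one, mul_assoc W, Matrix.diagonal_mul_diagonal]
        simp [hP, hW]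
  rw [ratMatrix, hinv, aeval_eq_of_diagonalization hW hB]
  calc _ = W * Matrix.diagonal (fun k => (P.denom.eval (z k))⁻¹) * (W * W) *
          Matrix.diagonal (fun k => P.num.eval (z k)) * W := by noncomm_ring
    _ = _ := by
      rw [hW, mul_one, mul_assoc W, Matrix.diagonal_mul_diagonal]
      simp only [RatFunc.eval, eval₂_id, div_eq_inv_mul]

theorem pow_eq_of_diagonalization (hW : W * W = 1) {M : Matrix ι ι ℝ}
    (hM : M = W * Matrix.diagonal z * W) (m : ℕ) :
    M ^ m = W * Matrix.diagonal (fun k => z k ^ m) * W := by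
  have h := aeval_eq_of_diagonalization (B := M) (z := z) hW (by rw [hM, mul_assoc, hW, mul_one])
    (X ^ m)
  simpa using h

end Diagonalization

/-! ### Propagation of the local errors -/

/-- Discrete Duhamel formula: the error added in step m has passed through n-1-m further steps. -/
theorem RungeKutta.globalError_eq_sum {s : ℕ} (rk : RungeKutta s) (d K : ℕ) (dt : ℝ)
    (f : ℝ → GridIndex d K → ℝ) (U0 : GridIndex d K → ℝ) (e : ℕ → GridIndex d K → ℝ) (n : ℕ) :
    rk.globalError d K dt f U0 e n =
      ∑ m ∈ Finset.range n, (ratMatrix rk.S (-(dt • fdLaplacian d K)) ^ (n - 1 - m)) *ᵥ e m := by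
  induction n with
  | zero => simp [RungeKutta.globalError, RungeKutta.scheme]
  | succ n ih =>
    have hrec : rk.globalError d K dt f U0 e (n + 1) =
        ratMatrix rk.S (-(dt • fdLaplacian d K)) *ᵥ rk.globalError d K dt f U0 e n + e n := by
      simp only [RungeKutta.globalError, RungeKutta.scheme, RungeKutta.step, Matrix.mulVec_sub,
        Pi.zero_apply]
      abel
    rw [hrec, ih, Finset.sum_range_succ, Matrix.mulVec_sum]
    congr 1
    · refine Finset.sum_congr rfl fun m hm => ?_
      rw [Finset.mem_range] at hm
      rw [Matrix.mulVec_mulVec, ← pow_succ', show n - 1 - m + 1 = n + 1 - 1 - m by omega]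
    · simp

theorem RungeKutta.globalError_apply_eq_sum {s : ℕ} (rk : RungeKutta s) (d K : ℕ) (dt : ℝ)
    (f : ℝ → GridIndex d K → ℝ) (U0 : GridIndex d K → ℝ) (e : ℕ → GridIndex d K → ℝ) (n : ℕ)
    (j : GridIndex d K) :
    rk.globalError d K dt f U0 e n j =
      ∑ p ∈ Finset.range n ×ˢ (Finset.univ : Finset (GridIndex d K)),
        (ratMatrix rk.S (-(dt • fdLaplacian d K)) ^ (n - 1 - p.1)) j p.2 * e p.1 p.2 := by
  rw [rk.globalError_eq_sum, Finset.sum_product, Finset.sum_apply]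
  rfl

theorem sum_range_prod_reflect {ι : Type*} [Fintype ι] (g : ℕ → ι → ℝ) (n : ℕ) :
    ∑ p ∈ Finset.range n ×ˢ (Finset.univ : Finset ι), g (n - 1 - p.1) p.2 =
      ∑ k ∈ Finset.range n, ∑ i, g k i := by
  rw [Finset.sum_product]
  exact Finset.sum_range_reflect (fun k => ∑ i, g k i) n

theorem geom_sum_le_inv_one_sub {x : ℝ} (hx0 : 0 ≤ x) (hx1 : x < 1) (n : ℕ) :
    ∑ k ∈ Finset.range n, x ^ k ≤ (1 - x)⁻¹ := by
  rw [inv_eq_one_div, le_div_iff₀ (by linarith), geom_sum_mul_neg]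
  linarith [pow_nonneg hx0 n]

section Variance

variable {ι : Type*} [Fintype ι] [DecidableEq ι] {W M : Matrix ι ι ℝ} {g : ι → ℝ}

/-- `M` is symmetric, so the squared length of row `j` of `M ^ m` is a diagonal entry of `M ^ (2m)`.
-/
theorem sum_pow_apply_sq_eq (hW : W * W = 1) (hsymm : ∀ i k, W i k = W k i)
    (hM : M = W * Matrix.diagonal g * W) (m : ℕ) (j : ι) :
    ∑ i, (M ^ m) j i ^ 2 = ∑ k, W j k ^ 2 * (g k ^ 2) ^ m := by
  have hent : ∀ m i j, (M ^ m) i j = ∑ k, W i k * g k ^ m * W k j := by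
    intro m i j
    rw [pow_eq_of_diagonalization hW hM, Matrix.mul_apply]
    simp [Matrix.mul_diagonal]
  have hsM : ∀ i, (M ^ m) j i ^ 2 = (M ^ m) j i * (M ^ m) i j := by
    intro i
    rw [sq, hent m i j, hent m j i]
    congr 1
    refine Finset.sum_congr rfl fun k _ => ?_
    rw [hsymm j k, hsymm k i]
    ring
  simp_rw [hsM]
  rw [← Matrix.mul_apply, ← pow_add, hent]
  refine Finset.sum_congr rfl fun k _ => ?_
  rw [hsymm k j, ← pow_mul, ← two_mul]
  ring

theorem sum_range_sum_pow_apply_sq_le (hW : W * W = 1) (hsymm : ∀ i k, W i k = W k i)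
    (hM : M = W * Matrix.diagonal g * W) (hg : ∀ k, g k ^ 2 < 1) (n : ℕ) (j : ι) :
    ∑ m ∈ Finset.range n, ∑ i, (M ^ m) j i ^ 2 ≤ ∑ k, W j k ^ 2 * (1 - g k ^ 2)⁻¹ := by
  simp_rw [sum_pow_apply_sq_eq hW hsymm hM]
  rw [Finset.sum_comm]
  refine Finset.sum_le_sum fun k _ => ?_
  rw [← Finset.mul_sum]
  exact mul_le_mul_of_nonneg_left (geom_sum_le_inv_one_sub (sq_nonneg _) (hg k) n) (sq_nonneg _)

theorem sum_sq_eq_one_of_mul_self (hW : W * W = 1) (hsymm : ∀ i k, W i k = W k i) (k : ι) :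
    ∑ j, W j k ^ 2 = 1 := by
  have := congrFun (congrFun hW k) k
  rw [Matrix.mul_apply, Matrix.one_apply_eq] at this
  rw [← this]
  refine Finset.sum_congr rfl fun j _ => ?_
  rw [hsymm k j, sq]

end Variance

/-! ### The local errors of the delta form -/

theorem leadingLocalError_eq {Ω ι : Type*} (D Uhat : ℕ → Ω → ι → ℝ) (ω : Ω) (n : ℕ) (j : ι) :
    leadingLocalError D Uhat ω n j = Uhat n ω j / (Uhat n ω j + D n ω j) *
      (Uhat (n + 1) ω j - (Uhat n ω j + D n ω j)) := by
  rw [leadingLocalError, roundoff]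
  ring

section DeltaForm

variable {Ω : Type*} [mΩ : MeasurableSpace Ω] {μ : Measure Ω} {t : ℕ} {ι : Type*} {U0 : ι → ℝ}
  {N : ℕ} {𝒢 : Filtration ℕ mΩ} {time : ℕ → ι → ℕ} {D Uhat : ℕ → Ω → ι → ℝ}

theorem IsDeltaFormSR.abs_leadingLocalError_le (h : IsDeltaFormSR μ t U0 N 𝒢 time D Uhat)
    (ht : 1 ≤ t) {n : ℕ} (hn : n < N) (j : ι) :
    ∀ᵐ ω ∂μ, |leadingLocalError D Uhat ω n j| ≤ 2 * unitRoundoff t * |Uhat n ω j| := by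
  filter_upwards [(h.rounding n hn j).mem] with ω hω
  rw [leadingLocalError, abs_mul]
  refine mul_le_mul_of_nonneg_right ?_ (abs_nonneg _)
  rw [roundoff, abs_div]
  set x := Uhat n ω j + D n ω j
  have h1 := roundDown_le ht x
  have h2 := le_roundUp ht x
  have h3 := roundUp_sub_roundDown_le ht x
  have hu : 0 ≤ 2 * unitRoundoff t := by
    rw [unitRoundoff]
    positivity
  -- This form also covers x = 0, where the quotient is 0 by convention.
  refine div_le_of_le_mul₀ (abs_nonneg _) hu (abs_le.2 ?_)
  rcases hω with hω | hω <;> rw [hω] <;> constructor <;> linarith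

theorem IsDeltaFormSR.isMartingaleDifference [Fintype ι] [IsProbabilityMeasure μ]
    (h : IsDeltaFormSR μ t U0 N 𝒢 time D Uhat) (ht : 1 ≤ t) {ε : ℝ} (hε : 0 ≤ ε)
    (hb : ∀ n < N, ∀ᵐ ω ∂μ, ∀ j, |leadingLocalError D Uhat ω n j| ≤ ε) {n : ℕ} (hn : n ≤ N) :
    IsMartingaleDifference μ 𝒢 (Finset.range n ×ˢ (Finset.univ : Finset ι))
      (fun p => time p.1 p.2) (fun p ω => leadingLocalError D Uhat ω p.1 p.2) ε := by
  have hlt : ∀ p ∈ Finset.range n ×ˢ (Finset.univ : Finset ι), p.1 < N := by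
    intro p hp
    rw [Finset.mem_product, Finset.mem_range] at hp
    exact hp.1.trans_le hn
  have hbd : ∀ p ∈ Finset.range n ×ˢ (Finset.univ : Finset ι),
      ∀ᵐ ω ∂μ, |leadingLocalError D Uhat ω p.1 p.2| ≤ ε := by
    intro p hp
    filter_upwards [hb p.1 (hlt p hp)] with ω hω
    exact hω p.2
  refine ⟨?_, ?_, hbd, ?_⟩
  · intro p hp q hq hpq
    obtain ⟨h1, h2⟩ := h.time_inj p.1 (hlt p hp) q.1 (hlt q hq) p.2 q.2 hpq
    exact Prod.ext h1 h2
  · intro p hp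
    have hp' := hlt p hp
    have hle : 𝒢 (time p.1 p.2) ≤ 𝒢 (time p.1 p.2 + 1) := 𝒢.mono (Nat.le_succ _)
    have h1 := (h.measurable_current p.1 hp' p.2).mono hle le_rfl
    have h2 := (h.measurable_incr p.1 hp' p.2).mono hle le_rfl
    simp_rw [leadingLocalError_eq]
    exact (h1.div (h1.add h2)).mul ((h.measurable_next p.1 hp' p.2).sub (h1.add h2))
  · intro p hp
    have hp' := hlt p hp
    have h1 := h.measurable_current p.1 hp' p.2
    have h2 := h.measurable_incr p.1 hp' p.2
    have hbd' := hbd p hp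
    simp_rw [leadingLocalError_eq] at hbd' ⊢
    exact (h.rounding p.1 hp' p.2).condExp_mul_sub_eq_zero ht (𝒢.le _) (h1.div (h1.add h2)) hε hbd'

end DeltaForm

/-! ### Rates -/

/-- The eigenvalues of `-Δt A`. -/
noncomputable def stepEigenvalue (d K : ℕ) (lam : ℝ) (p : GridIndex d K) : ℝ :=
  -(lam * ∑ l, secondDiffEigenvalue K (p l))

theorem stepEigenvalue_mem {d K : ℕ} {lam : ℝ} (hlam : 0 < lam) (p : GridIndex d K) :
    -(4 * d * lam) ≤ stepEigenvalue d K lam p := by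
  have h : ∑ l, secondDiffEigenvalue K (p l) ≤ ∑ _ : Fin d, (4 : ℝ) := by
    refine Finset.sum_le_sum fun l _ => ?_
    rw [secondDiffEigenvalue]
    linarith [Real.sin_sq_le_one ((((p l : ℕ) : ℝ) + 1) * Real.pi / (2 * K))]
  simp only [Finset.sum_const, Finset.card_univ, Fintype.card_fin, nsmul_eq_mul] at h
  rw [stepEigenvalue]
  nlinarith

/-- Jordan's inequality sin x ≥ 2x/π on [0, π/2]. -/
theorem le_secondDiffEigenvalue {K : ℕ} (b : Fin (K - 1)) :
    4 * (((b : ℕ) : ℝ) + 1) ^ 2 / K ^ 2 ≤ secondDiffEigenvalue K b := by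
  have hb := b.2
  have hK : (0 : ℝ) < K := by
    have : 0 < K := by omega
    exact_mod_cast this
  have hbK : ((b : ℕ) : ℝ) + 1 ≤ K := by
    have : (b : ℕ) + 1 ≤ K := by omega
    exact_mod_cast this
  have hpi := Real.pi_pos
  have h1 : (((b : ℕ) : ℝ) + 1) / K ≤ Real.sin ((((b : ℕ) : ℝ) + 1) * Real.pi / (2 * K)) := by
    refine le_trans (le_of_eq ?_) (Real.mul_le_sin (by positivity) ?_)
    · field_simp
    · rw [div_le_div_iff₀ (by positivity) two_pos]
      nlinarith
  calc 4 * (((b : ℕ) : ℝ) + 1) ^ 2 / K ^ 2 = 4 * ((((b : ℕ) : ℝ) + 1) / K) ^ 2 := by ring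
    _ ≤ _ := by
      rw [secondDiffEigenvalue]
      gcongr

theorem le_neg_stepEigenvalue {d K : ℕ} {lam : ℝ} (hlam : 0 < lam) (p : GridIndex d K) :
    4 * lam / K ^ 2 * ∑ l, (((p l : ℕ) : ℝ) + 1) ^ 2 ≤ -stepEigenvalue d K lam p := by
  rw [stepEigenvalue, neg_neg, Finset.mul_sum, Finset.mul_sum]
  refine Finset.sum_le_sum fun l _ => ?_
  refine le_trans (le_of_eq ?_) (mul_le_mul_of_nonneg_left (le_secondDiffEigenvalue (p l)) hlam.le)
  ring

theorem sum_freq_sq_pos {d K : ℕ} (hd : d ≠ 0) (p : GridIndex d K) :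
    0 < ∑ l, (((p l : ℕ) : ℝ) + 1) ^ 2 :=
  Finset.sum_pos (fun l _ => by positivity) ⟨⟨0, Nat.pos_of_ne_zero hd⟩, Finset.mem_univ _⟩

theorem stepEigenvalue_neg {d K : ℕ} (hd : d ≠ 0) (hK : 1 ≤ K) {lam : ℝ} (hlam : 0 < lam)
    (p : GridIndex d K) : stepEigenvalue d K lam p < 0 := by
  have h1 := le_neg_stepEigenvalue hlam p
  have h2 := sum_freq_sq_pos hd p
  have hK : (0 : ℝ) < K := by exact_mod_cast hK
  have : 0 < 4 * lam / K ^ 2 * ∑ l, (((p l : ℕ) : ℝ) + 1) ^ 2 := by positivity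
  linarith

theorem smul_fdLaplacian_mul_sineMatrix {d K : ℕ} (hK : 1 ≤ K) (lam : ℝ) :
    -((lam / (K : ℝ) ^ 2) • fdLaplacian d K) * sineMatrix d K =
      sineMatrix d K * Matrix.diagonal (stepEigenvalue d K lam) := by
  have hK : (0 : ℝ) < K := by exact_mod_cast hK
  ext i p
  rw [Matrix.neg_mul, Matrix.smul_mul, Matrix.neg_apply, Matrix.smul_apply, Matrix.mul_apply,
    fdLaplacian_mul_sineMatrix d K (by assumption), Matrix.mul_diagonal, stepEigenvalue, smul_eq_mul]
  field_simp

theorem phi_mul (d : ℕ) (a C lam dt : ℝ) : phi d (a * C) lam dt = a * phi d C lam dt := by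
  unfold phi
  split <;> ring

theorem RungeKutta.exists_sum_inv_le_phi {s : ℕ} (rk : RungeKutta s) (d : ℕ)
    (hd : d = 1 ∨ d = 2 ∨ d = 3) (lam : ℝ) (hlam : 0 < lam)
    (hpole : ∀ z : ℝ, z < 0 → rk.S.denom.eval z ≠ 0)
    (hstab : ∀ z : ℝ, -(4 * d * lam) ≤ z → z < 0 → |rk.S.eval (RingHom.id ℝ) z| < 1) :
    ∃ C > 0, ∀ K : ℕ, 1 ≤ K →
      ∑ p : GridIndex d K, (1 - rk.S.eval (RingHom.id ℝ) (stepEigenvalue d K lam p) ^ 2)⁻¹ ≤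
        phi d C lam (lam / K ^ 2) := by
  have hd0 : d ≠ 0 := by omega
  obtain ⟨c, hc, hcS⟩ := rk.exists_le_one_sub_S_sq (4 * d * lam) (by positivity) hpole hstab
  obtain ⟨C, hC, hsum⟩ := exists_lattice_sum_le_phi d hd lam hlam
  refine ⟨(4 * c * lam)⁻¹ * C, by positivity, fun K hK => ?_⟩
  rw [phi_mul]
  refine le_trans ?_ (mul_le_mul_of_nonneg_left (hsum K hK) (by positivity))
  rw [Finset.mul_sum, Finset.mul_sum]
  refine Finset.sum_le_sum fun p _ => ?_
  have h1 := hcS _ (stepEigenvalue_mem hlam p) (stepEigenvalue_neg hd0 hK hlam p)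
  have h2 := mul_le_mul_of_nonneg_left (le_neg_stepEigenvalue hlam p) hc.le
  have h3 := sum_freq_sq_pos hd0 p
  have hK' : (0 : ℝ) < K := by exact_mod_cast hK
  refine (inv_anti₀ (by positivity) (h2.trans h1)).trans (le_of_eq ?_)
  field_simp

/-- Both sides are h^(d/2), the normalization of the discrete L² norm. -/
theorem rpow_mul_rpow_div_sq {lam : ℝ} (hlam : 0 < lam) {K : ℕ} (hK : 1 ≤ K) (d : ℕ) :
    lam ^ (-(d : ℝ) / 4) * (lam / (K : ℝ) ^ 2) ^ ((d : ℝ) / 4) = (K : ℝ) ^ (-(d : ℝ) / 2) := by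
  have hK' : (0 : ℝ) < K := by exact_mod_cast hK
  rw [Real.div_rpow hlam.le (by positivity), ← mul_div_assoc, ← Real.rpow_add hlam,
    ← Real.rpow_natCast (K : ℝ) 2, ← Real.rpow_mul hK'.le]
  rw [show -(d : ℝ) / 4 + d / 4 = 0 by ring, Real.rpow_zero, one_div, ← Real.rpow_neg hK'.le]
  congr 1
  push_cast
  ring

theorem rpow_mul_sqrt_phi (d : ℕ) (hd : d = 1 ∨ d = 2 ∨ d = 3) {C lam dt : ℝ} (hC : 0 < C)
    (hdt : 0 < dt) : dt ^ ((d : ℝ) / 4) * √(phi d C lam dt) = √C * rateL2 d lam dt := by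
  have key : ∀ a b x : ℝ, 0 ≤ x → dt ^ a * √(C * dt ^ b * x) = √C * (dt ^ (a + b / 2) * √x) := by
    intro a b x hx
    rw [Real.sqrt_mul (by positivity), Real.sqrt_mul hC.le, Real.sqrt_eq_rpow (dt ^ b),
      ← Real.rpow_mul hdt.le, Real.rpow_add hdt]
    ring_nf
  rcases hd with rfl | rfl | rfl
  · have := key (1 / 4) (-1) 1 zero_le_one
    rw [Real.rpow_neg_one] at this
    norm_num at this
    norm_num [phi, rateL2, this]
  · have := key (1 / 2) (-1) (ell lam dt) (abs_nonneg _)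
    rw [Real.rpow_neg_one] at this
    norm_num at this
    norm_num [phi, rateL2, this]
  · have := key (3 / 4) (-(3 / 2)) 1 zero_le_one
    norm_num at this
    norm_num [phi, rateL2, this]

theorem rateMax_eq (d : ℕ) (lam dt : ℝ) :
    rateMax d lam dt = rateL2 d lam dt * √(ell lam dt) := by
  unfold rateMax rateL2
  split
  · rfl
  · exact (Real.mul_self_sqrt (abs_nonneg _)).symm
  · rw [one_mul]
  · rw [zero_mul]

theorem rateL2_nonneg (d : ℕ) (lam : ℝ) {dt : ℝ} (hdt : 0 < dt) : 0 ≤ rateL2 d lam dt := by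
  unfold rateL2
  split <;> positivity

/-! ### The main theorem -/

theorem integral_discreteL2Norm_sq_le {Ω : Type*} [mΩ : MeasurableSpace Ω] {μ : Measure Ω}
    {d K : ℕ} {X : Ω → GridIndex d K → ℝ} {ε A : ℝ} {V : GridIndex d K → ℝ}
    (hint : ∀ j, Integrable (fun ω => X ω j ^ 2) μ) (hX : ∀ j, ∫ ω, X ω j ^ 2 ∂μ ≤ ε ^ 2 * V j)
    (hε : 0 ≤ ε) (hV : ∑ j, V j ≤ A) :
    Integrable (fun ω => discreteL2Norm d K (X ω) ^ 2) μ ∧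
      √(∫ ω, discreteL2Norm d K (X ω) ^ 2 ∂μ) ≤ ε * (K : ℝ) ^ (-(d : ℝ) / 2) * √A := by
  have hsq : ∀ ω, discreteL2Norm d K (X ω) ^ 2 =
      ((K : ℝ) ^ (-(d : ℝ) / 2)) ^ 2 * ∑ j, X ω j ^ 2 := by
    intro ω
    rw [discreteL2Norm, mul_pow, Real.sq_sqrt (Finset.sum_nonneg fun j _ => sq_nonneg _)]
  have hKp : 0 ≤ (K : ℝ) ^ (-(d : ℝ) / 2) := by positivity
  simp_rw [hsq]
  refine ⟨(integrable_finsetSum _ fun j _ => hint j).const_mul _, ?_⟩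
  rw [integral_const_mul, integral_finsetSum _ fun j _ => hint j, Real.sqrt_mul (sq_nonneg _),
    Real.sqrt_sq hKp]
  have h1 : ∑ j, ∫ ω, X ω j ^ 2 ∂μ ≤ ε ^ 2 * A := by
    refine (Finset.sum_le_sum fun j _ => hX j).trans ?_
    rw [← Finset.mul_sum]
    exact mul_le_mul_of_nonneg_left hV (sq_nonneg _)
  calc _ ≤ (K : ℝ) ^ (-(d : ℝ) / 2) * √(ε ^ 2 * A) := by gcongr
    _ = _ := by
      rw [Real.sqrt_mul (sq_nonneg _), Real.sqrt_sq hε]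
      ring

theorem mainTheorem1 {s : ℕ} (rk : RungeKutta s) (d : ℕ) (hd : d = 1 ∨ d = 2 ∨ d = 3)
    (lam : ℝ) (hlam : 0 < lam)
    (hpole : ∀ z : ℝ, z < 0 → rk.S.denom.eval z ≠ 0)
    (hstab : ∀ z : ℝ, -(4 * d * lam) ≤ z → z < 0 → |rk.S.eval (RingHom.id ℝ) z| < 1) :
    ∃ C > 0, ∃ C' > 0, ∀ (K : ℕ) (h dt : ℝ), 1 ≤ K → h = 1 / K → lam = dt / h ^ 2 →
      ∀ (Ω : Type*) [mΩ : MeasurableSpace Ω] (μ : Measure Ω) [IsProbabilityMeasure μ]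
        (t : ℕ) (_ : 1 ≤ t) (f : ℝ → GridIndex d K → ℝ) (U0 : GridIndex d K → ℝ)
        (N : ℕ) (𝒢 : Filtration ℕ mΩ) (time : ℕ → GridIndex d K → ℕ)
        (D Uhat : ℕ → Ω → GridIndex d K → ℝ), IsDeltaFormSR μ t U0 N 𝒢 time D Uhat →
        -- the leading local errors are at most `2 u M` if `Uhat` is bounded by `M`
        (∀ M : ℝ, (∀ n < N, ∀ᵐ ω ∂μ, ‖Uhat n ω‖ ≤ M) →
          ∀ n < N, ∀ᵐ ω ∂μ, ∀ j, |leadingLocalError D Uhat ω n j| ≤ 2 * unitRoundoff t * M) ∧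
        -- bounds for the global error in terms of a bound `ε` of the leading local errors
        ∀ ε : ℝ, 0 ≤ ε →
          (∀ n < N, ∀ᵐ ω ∂μ, ∀ j, |leadingLocalError D Uhat ω n j| ≤ ε) →
          ∀ E : ℕ → Ω → GridIndex d K → ℝ,
            (∀ n ω, E n ω = rk.globalError d K dt f U0 (leadingLocalError D Uhat ω) n) →
            ∀ n ≤ N,
              (Integrable (fun ω => discreteL2Norm d K (E n ω) ^ 2) μ ∧
                Integrable (fun ω => ‖E n ω‖) μ) ∧
              √(∫ ω, discreteL2Norm d K (E n ω) ^ 2 ∂μ) ≤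
                ε * lam ^ (-(d : ℝ) / 4) * dt ^ ((d : ℝ) / 4) * √(phi d C lam dt) ∧
              √(∫ ω, discreteL2Norm d K (E n ω) ^ 2 ∂μ) ≤ C' * ε * rateL2 d lam dt ∧
              ∫ ω, ‖E n ω‖ ∂μ ≤
                2 ^ (2 + (d : ℝ) / 2) * lam ^ (-(d : ℝ) / 4) * ε * dt ^ ((d : ℝ) / 4) *
                  √(phi d C lam dt) *
                  √((d : ℝ) / 2 * Real.log (lam * dt⁻¹) + Real.log 2) ∧
              ∫ ω, ‖E n ω‖ ∂μ ≤ C' * ε * rateMax d lam dt := by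
  have hd0 : d ≠ 0 := by omega
  obtain ⟨C, hC, hsum⟩ := rk.exists_sum_inv_le_phi d hd lam hlam hpole hstab
  -- The constant of the maximum norm bound, with a final factor 2 from R ≤ 2√ℓ; it also dominates
  -- the L² constant.
  refine ⟨C, hC, 2 ^ (2 + (d : ℝ) / 2) * lam ^ (-(d : ℝ) / 4) * √C * 2, by positivity, ?_⟩
  intro K h dt hK hh hdt Ω mΩ μ hμ t ht f U0 N 𝒢 time D Uhat hSR
  have hK' : (0 : ℝ) < K := by exact_mod_cast hK
  have hK1 : (1 : ℝ) ≤ K := by exact_mod_cast hK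
  obtain rfl : dt = lam / (K : ℝ) ^ 2 := by
    rw [hdt, hh]
    field_simp
  have hdt0 : 0 < lam / (K : ℝ) ^ 2 := by positivity
  refine ⟨?_, ?_⟩
  · intro M hM n hn
    filter_upwards [hM n hn, ae_all_iff.2 fun j => hSR.abs_leadingLocalError_le ht hn j]
      with ω h1 h2 j
    refine (h2 j).trans (mul_le_mul_of_nonneg_left ((norm_le_pi_norm (Uhat n ω) j).trans h1) ?_)
    rw [unitRoundoff]
    positivity
  intro ε hε hbd E hE n hn
  have hmd := hSR.isMartingaleDifference ht hε hbd hn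
  set S := ratMatrix rk.S (-((lam / (K : ℝ) ^ 2) • fdLaplacian d K)) with hS
  set g : GridIndex d K → ℝ :=
    fun p => rk.S.eval (RingHom.id ℝ) (stepEigenvalue d K lam p) with hg
  set A := phi d C lam (lam / (K : ℝ) ^ 2) with hA
  have hSd : S = sineMatrix d K * Matrix.diagonal g * sineMatrix d K :=
    ratMatrix_eq_of_diagonalization (sineMatrix_mul_self d K)
      (smul_fdLaplacian_mul_sineMatrix hK lam) rk.S
      fun p => hpole _ (stepEigenvalue_neg hd0 hK hlam p)
  have hg1 : ∀ p, g p ^ 2 < 1 := fun p => (sq_lt_one_iff_abs_lt_one _).2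
    (hstab _ (stepEigenvalue_mem hlam p) (stepEigenvalue_neg hd0 hK hlam p))
  have hinv0 : ∀ p, 0 ≤ (1 - g p ^ 2)⁻¹ := fun p => inv_nonneg.2 (by linarith [hg1 p])
  have hsumA : ∑ p, (1 - g p ^ 2)⁻¹ ≤ A := hsum K hK
  have hA0 : 0 ≤ A := (Finset.sum_nonneg fun p _ => hinv0 p).trans hsumA
  set V : GridIndex d K → ℝ := fun j => ∑ m ∈ Finset.range n, ∑ i, (S ^ m) j i ^ 2 with hV
  have hVle : ∀ j, V j ≤ ∑ p, sineMatrix d K j p ^ 2 * (1 - g p ^ 2)⁻¹ := fun j =>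
    sum_range_sum_pow_apply_sq_le (sineMatrix_mul_self d K) (sineMatrix_symm d K) hSd hg1 n j
  have hVmax : ∀ j, V j ≤ (2 / K) ^ d * A := by
    intro j
    refine (hVle j).trans (le_trans ?_ (mul_le_mul_of_nonneg_left hsumA (by positivity)))
    rw [Finset.mul_sum]
    exact Finset.sum_le_sum fun p _ =>
      mul_le_mul_of_nonneg_right (sineMatrix_sq_le d K j p) (hinv0 p)
  have hVsum : ∑ j, V j ≤ A := by
    refine (Finset.sum_le_sum fun j _ => hVle j).trans (le_trans (le_of_eq ?_) hsumA)
    rw [Finset.sum_comm]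
    refine Finset.sum_congr rfl fun p _ => ?_
    rw [← Finset.sum_mul, sum_sq_eq_one_of_mul_self (sineMatrix_mul_self d K) (sineMatrix_symm d K),
      one_mul]
  set c : GridIndex d K → ℕ × GridIndex d K → ℝ := fun j p => (S ^ (n - 1 - p.1)) j p.2 with hc
  have hcV : ∀ j, ∑ p ∈ Finset.range n ×ˢ (Finset.univ : Finset (GridIndex d K)), c j p ^ 2 =
      V j := fun j => sum_range_prod_reflect (fun k i => (S ^ k) j i ^ 2) n
  have hEc : ∀ ω j, E n ω j = ∑ p ∈ Finset.range n ×ˢ (Finset.univ : Finset (GridIndex d K)),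
      c j p * leadingLocalError D Uhat ω p.1 p.2 := by
    intro ω j
    rw [hE, rk.globalError_apply_eq_sum]
  have hE2i : ∀ j, Integrable (fun ω => E n ω j ^ 2) μ := by
    intro j
    simp_rw [hEc]
    exact hmd.integrable_sum_sq (c j)
  have hE2 : ∀ j, ∫ ω, E n ω j ^ 2 ∂μ ≤ ε ^ 2 * V j := by
    intro j
    simp_rw [hEc, ← hcV]
    exact hmd.integral_sum_sq_le (c j)
  have hEi : Integrable (fun ω => ‖E n ω‖) μ := by
    refine Integrable.norm (Integrable.of_eval fun j => ?_)
    simp_rw [hEc]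
    exact integrable_finsetSum _ fun p hp => (hmd.integrable hp).const_mul _
  have hscale : ∀ θ ω j, θ * E n ω j =
      ∑ p ∈ Finset.range n ×ˢ (Finset.univ : Finset (GridIndex d K)),
        θ * c j p * leadingLocalError D Uhat ω p.1 p.2 := by
    intro θ ω j
    rw [hEc, Finset.mul_sum]
    simp_rw [mul_assoc]
  obtain ⟨hL2i, hL2⟩ := integral_discreteL2Norm_sq_le hE2i hE2 hε hVsum
  have hrate := rpow_mul_sqrt_phi d hd (lam := lam) hC hdt0
  have hr0 := rateL2_nonneg d lam hdt0
  have hkap := rpow_mul_rpow_div_sq hlam hK d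
  have hell := ell_eq hlam hK
  have hlog : Real.log (lam * (lam / (K : ℝ) ^ 2)⁻¹) = 2 * Real.log K := by
    rw [show lam * (lam / (K : ℝ) ^ 2)⁻¹ = (K : ℝ) ^ 2 by field_simp, Real.log_pow]
    norm_num
  have hlogK : 0 ≤ Real.log K := Real.log_nonneg hK1
  have h2d : (1 : ℝ) ≤ 2 ^ (2 + (d : ℝ) / 2) := Real.one_le_rpow one_le_two (by positivity)
  set R := √((d : ℝ) / 2 * Real.log (lam * (lam / (K : ℝ) ^ 2)⁻¹) + Real.log 2) with hR
  have hmax : ∫ ω, ‖E n ω‖ ∂μ ≤ 2 ^ (2 + (d : ℝ) / 2) * lam ^ (-(d : ℝ) / 4) * ε *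
      (lam / (K : ℝ) ^ 2) ^ ((d : ℝ) / 4) * √A * R := by
    -- The grid is empty for K = 1, where the maximal inequality does not apply but the error is
    -- trivially zero.
    rcases isEmpty_or_nonempty (GridIndex d K) with hemp | hne
    · have : ∀ ω, ‖E n ω‖ = 0 := fun ω => by
        rw [Subsingleton.elim (E n ω) 0, norm_zero]
      simp_rw [this, integral_zero]
      positivity
    · have hsub := integral_norm_le_of_subgaussian (μ := μ) (X := fun ω => E n ω)
        (σ := ε * √((2 / K) ^ d * A)) (by positivity) hEi
        (fun θ j => by simp_rw [hscale]; exact hmd.integrable_exp_sum _)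
        (fun θ j => by
          simp_rw [hscale]
          refine (hmd.integral_exp_sum_le hε _).trans (Real.exp_le_exp.2 ?_)
          simp_rw [mul_pow]
          rw [← Finset.mul_sum, hcV, Real.sq_sqrt (by positivity)]
          have := mul_le_mul_of_nonneg_left (hVmax j) (mul_nonneg (sq_nonneg ε) (sq_nonneg θ))
          linarith)
      have hcard : Real.log (2 * Fintype.card (GridIndex d K)) ≤
          (d : ℝ) / 2 * (2 * Real.log K) + Real.log 2 := by
        have h1 : (Fintype.card (GridIndex d K) : ℝ) ≤ (K : ℝ) ^ d := by
          rw [Fintype.card_fun, Fintype.card_fin, Fintype.card_fin]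
          push_cast
          gcongr
          exact Nat.sub_le K 1
        have h2 : (0 : ℝ) < Fintype.card (GridIndex d K) := by
          exact_mod_cast (Fintype.card_pos : 0 < Fintype.card (GridIndex d K))
        calc _ ≤ Real.log (2 * (K : ℝ) ^ d) := Real.log_le_log (by positivity) (by linarith)
          _ = _ := by
            rw [Real.log_mul two_ne_zero (by positivity), Real.log_pow]
            ring
      -- Only √2 is needed; the cruder 4 produces the factor 2² in the stated constant.
      have hsq2 : √(2 * Real.log (2 * Fintype.card (GridIndex d K))) ≤ 4 * R := by
        rw [hR, hlog]
        refine (Real.sqrt_le_sqrt (mul_le_mul_of_nonneg_left hcard zero_le_two)).trans ?_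
        rw [Real.sqrt_mul zero_le_two]
        refine mul_le_mul_of_nonneg_right ?_ (Real.sqrt_nonneg _)
        rw [Real.sqrt_le_left (by norm_num)]
        norm_num
      have hsig : √((2 / (K : ℝ)) ^ d * A) = 2 ^ ((d : ℝ) / 2) * (K : ℝ) ^ (-(d : ℝ) / 2) * √A := by
        rw [Real.sqrt_mul (by positivity), Real.sqrt_eq_rpow ((2 / (K : ℝ)) ^ d),
          ← Real.rpow_natCast, ← Real.rpow_mul (by positivity), Real.div_rpow two_pos.le hK'.le,
          div_eq_mul_inv, ← Real.rpow_neg hK'.le]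
        congr 3
        · ring
        · ring
      refine hsub.trans ((mul_le_mul_of_nonneg_left hsq2 (by positivity)).trans (le_of_eq ?_))
      rw [hsig, ← hkap, Real.rpow_add two_pos]
      norm_num
      ring
  refine ⟨⟨hL2i, hEi⟩, ?_, ?_, hmax, ?_⟩
  · refine hL2.trans (le_of_eq ?_)
    rw [← hkap]
    ring
  · refine hL2.trans ?_
    rw [← hkap]
    calc _ = ε * lam ^ (-(d : ℝ) / 4) * ((lam / (K : ℝ) ^ 2) ^ ((d : ℝ) / 4) * √A) := by ring
      _ = 1 * (lam ^ (-(d : ℝ) / 4) * √C * ε * rateL2 d lam (lam / (K : ℝ) ^ 2)) := by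
        rw [hrate]
        ring
      _ ≤ (2 ^ (2 + (d : ℝ) / 2) * 2) *
          (lam ^ (-(d : ℝ) / 4) * √C * ε * rateL2 d lam (lam / (K : ℝ) ^ 2)) := by
        gcongr
        linarith
      _ = _ := by ring
  · rw [rateMax_eq]
    rcases isEmpty_or_nonempty (GridIndex d K) with hemp | hne
    · have : ∀ ω, ‖E n ω‖ = 0 := fun ω => by
        rw [Subsingleton.elim (E n ω) 0, norm_zero]
      simp_rw [this, integral_zero]
      positivity
    -- A nonempty grid forces K ≥ 2, so log 2 ≤ log K can be absorbed into ℓ; for K = 1 this would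
    -- fail, as ℓ = 0.
    · have hRle : R ≤ 2 * √(ell lam (lam / (K : ℝ) ^ 2)) := by
        have hK2 : (2 : ℝ) ≤ K := by
          obtain ⟨i⟩ := hne
          have := (i ⟨0, Nat.pos_of_ne_zero hd0⟩).2
          have : 2 ≤ K := by omega
          exact_mod_cast this
        have h1 : Real.log 2 ≤ Real.log K := Real.log_le_log two_pos hK2
        have h2 : (d : ℝ) ≤ 3 := by
          have : d ≤ 3 := by omega
          exact_mod_cast this
        have h3 : (2 : ℝ) = √(2 ^ 2) := (Real.sqrt_sq two_pos.le).symm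
        rw [hR, hlog, hell]
        conv_rhs => rw [h3]
        rw [← Real.sqrt_mul (by positivity)]
        apply Real.sqrt_le_sqrt
        nlinarith
      refine hmax.trans ?_
      calc _ = 2 ^ (2 + (d : ℝ) / 2) * lam ^ (-(d : ℝ) / 4) * ε *
            ((lam / (K : ℝ) ^ 2) ^ ((d : ℝ) / 4) * √A) * R := by ring
        _ ≤ 2 ^ (2 + (d : ℝ) / 2) * lam ^ (-(d : ℝ) / 4) * ε *
            (√C * rateL2 d lam (lam / (K : ℝ) ^ 2)) *
              (2 * √(ell lam (lam / (K : ℝ) ^ 2))) := by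
          rw [hrate]
          gcongr
        _ = _ := by ring
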